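/- Let $m,s\ge 0$ be integers. Let $\mathbb C_m$ be the complex Clifford algebra with generators $e_1,\dots,e_m$ satisfying $e_je_k+e_ke_j=-2\delta_{jk}$. It has the basis $e_A=e_{j_1}\cdots e_{j_k}$, $A=\{j_1<\dots<j_k\}\subseteq\{1,\dots,m\}$, $e_\emptyset=1$. For $a=\sum_A a_Ae_A$, $a_A\in\mathbb C$, put $|a|^2=\sum_A|a_A|^2$ and $a^\dagger=\sum_A\overline{a_A}\,\overline{e_A}$, where $\overline{e_A}=(-e_{j_k})\cdots(-e_{j_1})$ is Clifford conjugation. All functions below take values in $\mathbb C_m$. Let $\partial_{\underline x}=\sum_{j=1}^m e_j\partial_{x_j}$ be the Dirac operator on $\mathbb R^m$ and $\partial_{\underline z}=\sum_{j=1}^m e_j\partial_{z_j}$ its complexification on $\mathbb C^m$. Let $\mathscr M^s(\mathbb R^m)$ be the set of smooth $g:\mathbb R^m\to\mathbb C_m$ with $\partial_{\underline x}^s g=0$. Let $$\mathcal D^s=\mathscr M^s(\mathbb R^m)\,e^{-|\underline x|^2/4}\cap L^2(\mathbb R^m)$$ be the set of functions $f(\underline x)=g(\underline x)e^{-|\underline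 x|^2/4}$ with $g\in\mathscr M^s(\mathbb R^m)$ and $\int_{\mathbb R^m}|f|^2\,d\underline x<\infty$, with the $\mathbb C_m$-valued inner product $$\langle f_1,f_2\rangle=\frac1{(2\pi)^{m/2}}\int_{\mathbb R^m}f_1(\underline x)^\dagger f_2(\underline x)\,d\underline x .$$ Let the $s$-monogenic Bargmann module $\mathscr{MB}^s(\mathbb C^m)$ be the set of entire $h:\mathbb C^m\to\mathbb C_m$ with $\partial_{\underline z}^sh=0$ and $\int_{\mathbb C^m}e^{-|\underline z|^2}|h(\underline z)|^2\,d\underline x\,d\underline y<\infty$, where $\underline z=\underline x+i\underline y$, with the inner product $$\langle h_1,h_2\rangle=\frac1{\pi^m}\int_{\mathbb C^m}e^{-|\underline z|^2}h_1(\underline z)^\dagger h_2(\underline z)\,d\underline x\,d\underline y .$$ The Segal-Bargmann transform is $$\mathcal B[f](\underline z)=\frac1{(2\pi)^{m/2}}\int_{\mathbb R^m}\exp\Big(-\frac{\underline z\cdot\underline z}2+\underline x\cdot\underline z-\frac{\underline x\cdot\underline x}4\Big)f(\underline x)\,d\underline x,\qquad \underline x\cdot\underline z=\sum_{j=1}^mx_jz_j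 .$$ **Proposition.** The map $\mathcal B:\mathcal D^s\to\mathscr{MB}^s(\mathbb C^m)$ is a unitary isomorphism. That is: 1. For every $f\in\mathcal D^s$ the integral defining $\mathcal B[f](\underline z)$ converges absolutely for every $\underline z\in\mathbb C^m$. 2. $\mathcal D^s$ is closed under right $\mathbb C_m$-linear combinations, and $\mathcal B[f_1a+f_2b]=\mathcal B[f_1]a+\mathcal B[f_2]b$ for $f_1,f_2\in\mathcal D^s$ and $a,b\in\mathbb C_m$. 3. $\mathcal B$ maps $\mathcal D^s$ bijectively onto $\mathscr{MB}^s(\mathbb C^m)$. 4. For all $f_1,f_2\in\mathcal D^s$ the integrals defining $\langle f_1,f_2\rangle$ and $\langle\mathcal B[f_1],\mathcal B[f_2]\rangle$ converge absolutely, and $\langle\mathcal B[f_1],\mathcal B[f_2]\rangle=\langle f_1,f_2\rangle$. 5. $\mathcal B$ is an isometry: for every $f\in\mathcal D^s$, $$\frac1{\pi^m}\int_{\mathbb C^m}e^{-|\underline z|^2}\,|\mathcal B[f](\underline z)|^2\,d\underline x\,d\underline y=\frac1{(2\pi)^{m/2}}\int_{\mathbb R^m}|f(\underline x)|^2\,d\underline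 x .$$ -/

import Mathlib

open MeasureTheory

noncomputable section

/-! ### The complex Clifford algebra `ℂ_m` -/

/-- The complex quadratic form `Q(v) = -∑ j, v j ^ 2` on `ℂ^m`. -/
def cliffordForm (m : ℕ) : QuadraticForm ℂ (Fin m → ℂ) :=
  QuadraticMap.weightedSumSquares ℂ (fun _ : Fin m => (-1 : ℂ))

/-- The complex Clifford algebra `ℂ_m`: the associative unital complex algebra generated by
`e_1, …, e_m` with `e_j e_k + e_k e_j = -2 δ_{jk}`. -/
def ComplexClifford (m : ℕ) : Type :=
  CliffordAlgebra (cliffordForm m)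

instance (m : ℕ) : Ring (ComplexClifford m) :=
  inferInstanceAs (Ring (CliffordAlgebra (cliffordForm m)))

instance (m : ℕ) : Algebra ℂ (ComplexClifford m) :=
  inferInstanceAs (Algebra ℂ (CliffordAlgebra (cliffordForm m)))

/-- The generator `e_j`. -/
def cliffordGen {m : ℕ} (j : Fin m) : ComplexClifford m :=
  CliffordAlgebra.ι (cliffordForm m) (Pi.single j 1)

/-- The basis element `e_A = e_{j_1} ⋯ e_{j_k}` for `A = {j_1 < ⋯ < j_k}`, with `e_∅ = 1`. -/
def cliffordUnit {m : ℕ} (A : Finset (Fin m)) : ComplexClifford m :=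
  ((A.sort (· ≤ ·)).map cliffordGen).prod

/-- The defining relations of the generators. -/
theorem cliffordGen_mul_add_swap {m : ℕ} (j k : Fin m) :
    (cliffordGen j * cliffordGen k + cliffordGen k * cliffordGen j : ComplexClifford m)
      = if j = k then -2 else 0 := by
  have h := CliffordAlgebra.ι_mul_ι_add_swap (Q := cliffordForm m)
    (Pi.single j (1 : ℂ)) (Pi.single k 1)
  refine Eq.trans h ?_
  have h2 : QuadraticMap.polar (cliffordForm m) (Pi.single j (1 : ℂ)) (Pi.single k 1)
      = if j = k then -2 else 0 := by
    simp only [QuadraticMap.polar, cliffordForm, QuadraticMap.weightedSumSquares_apply,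
      ← Finset.sum_sub_distrib, Pi.add_apply, smul_eq_mul]
    rw [Finset.sum_eq_single j]
    · by_cases hjk : j = k
      · subst hjk; simp; norm_num
      · simp [hjk]
    · intro i _ hij
      simp [Pi.single_apply, hij]
    · simp
  rw [h2]
  by_cases hjk : j = k
  · simp only [hjk, if_true, map_neg, map_ofNat]; rfl
  · simp only [hjk, if_false, map_zero]; rfl

theorem contractLeft_list_prod_eq_zero {m : ℕ} (d : Module.Dual ℂ (Fin m → ℂ)) :
    ∀ l : List (Fin m), (∀ i ∈ l, d (Pi.single i 1) = 0) →
      CliffordAlgebra.contractLeft (Q := (0 : QuadraticForm ℂ (Fin m → ℂ))) d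
        ((l.map fun i => CliffordAlgebra.ι (0 : QuadraticForm ℂ (Fin m → ℂ))
          (Pi.single i 1)).prod) = 0
  | [], _ => by simp [CliffordAlgebra.contractLeft_one]
  | i :: l, h => by
      rw [List.map_cons, List.prod_cons, CliffordAlgebra.contractLeft_ι_mul,
        contractLeft_list_prod_eq_zero d l (fun k hk => h k (by simp [hk])), h i (by simp)]
      simp

theorem equivExterior_list_prod {m : ℕ} [Invertible (2 : ℂ)] :
    ∀ l : List (Fin m), l.Nodup →
      CliffordAlgebra.equivExterior (cliffordForm m)
          ((l.map fun i => CliffordAlgebra.ι (cliffordForm m) (Pi.single i 1)).prod)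
        = (l.map fun i => ExteriorAlgebra.ι ℂ (Pi.single i (1 : ℂ) : Fin m → ℂ)).prod
  | [], _ => by simp [CliffordAlgebra.changeForm_one]
  | i :: l, h => by
      have hl := List.nodup_cons.1 h
      have ih := equivExterior_list_prod l hl.2
      rw [CliffordAlgebra.equivExterior, CliffordAlgebra.changeFormEquiv_apply] at ih ⊢
      rw [List.map_cons, List.prod_cons, CliffordAlgebra.changeForm_ι_mul, ih, List.map_cons,
        List.prod_cons]
      refine (congrArg _ (contractLeft_list_prod_eq_zero _ l ?_)).trans (sub_zero _)
      intro k hk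
      have hik : i ≠ k := fun e => hl.1 (e ▸ hk)
      have h2 : QuadraticMap.polar (-cliffordForm m) (Pi.single i (1 : ℂ)) (Pi.single k 1) = 0 := by
        simp only [QuadraticMap.polar, cliffordForm, QuadraticMap.weightedSumSquares_apply,
          neg_apply, smul_eq_mul]
        simp only [← Finset.sum_neg_distrib, ← Finset.sum_sub_distrib]
        refine Finset.sum_eq_zero fun n _ => ?_
        by_cases h1 : n = i
        · subst h1; simp [hik]
        · simp [h1]
      rw [QuadraticMap.associated_apply]
      rw [QuadraticMap.polar] at h2
      rw [h2, smul_zero]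

theorem exteriorBasis_eq_list_prod {m : ℕ} (A : Finset (Fin m)) :
    (Pi.basisFun ℂ (Fin m)).ExteriorAlgebra A
      = ((A.sort (· ≤ ·)).map fun i =>
          ExteriorAlgebra.ι ℂ (Pi.single i (1 : ℂ) : Fin m → ℂ)).prod := by
  rw [ExteriorAlgebra.basis_apply_ofCard (s_card := rfl), ExteriorAlgebra.ιMulti_family,
    ExteriorAlgebra.ιMulti_apply]
  congr 1
  refine List.ext_getElem (by simp) fun n h1 h2 => ?_
  simp [Set.powersetCard.ofFinEmbEquiv_symm_apply, Finset.orderEmbOfFin_apply]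

/-- The elements `e_A` form a basis of `ℂ_m`. -/
def cliffordBasis (m : ℕ) : Module.Basis (Finset (Fin m)) ℂ (ComplexClifford m) :=
  letI : Invertible (2 : ℂ) := invertibleOfNonzero two_ne_zero
  (Pi.basisFun ℂ (Fin m)).ExteriorAlgebra.map
    (CliffordAlgebra.equivExterior (cliffordForm m)).symm

theorem cliffordBasis_apply {m : ℕ} (A : Finset (Fin m)) :
    cliffordBasis m A = cliffordUnit A := by
  let _ : Invertible (2 : ℂ) := invertibleOfNonzero two_ne_zero
  have h : cliffordBasis m A = (CliffordAlgebra.equivExterior (cliffordForm m)).symm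
      ((Pi.basisFun ℂ (Fin m)).ExteriorAlgebra A) := Module.Basis.map_apply _ _ _
  rw [h]
  refine (CliffordAlgebra.equivExterior (cliffordForm m)).injective
    ((LinearEquiv.apply_symm_apply _ _).trans ?_)
  exact (exteriorBasis_eq_list_prod A).trans
    (equivExterior_list_prod _ (Finset.sort_nodup _ _)).symm

/-- The coefficients `a_A ∈ ℂ` of `a = ∑_A a_A e_A`. -/
def cliffordCoeff {m : ℕ} : ComplexClifford m →ₗ[ℂ] EuclideanSpace ℂ (Finset (Fin m)) :=
  (WithLp.linearEquiv 2 ℂ (Finset (Fin m) → ℂ)).symm.toLinearMap ∘ₗ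
    (cliffordBasis m).equivFun.toLinearMap

theorem cliffordCoeff_injective {m : ℕ} : Function.Injective (cliffordCoeff (m := m)) :=
  (WithLp.linearEquiv 2 ℂ (Finset (Fin m) → ℂ)).symm.injective.comp
    (cliffordBasis m).equivFun.injective

theorem sum_cliffordCoeff {m : ℕ} (a : ComplexClifford m) :
    ∑ A, cliffordCoeff a A • cliffordUnit A = a := by
  have h := (cliffordBasis m).sum_equivFun a
  simp only [cliffordBasis_apply] at h
  exact h

/-- The norm `|a| = (∑_A |a_A|²)^{1/2}` on `ℂ_m`. -/
instance (m : ℕ) : NormedAddCommGroup (ComplexClifford m) :=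
  NormedAddCommGroup.induced (ComplexClifford m) (EuclideanSpace ℂ (Finset (Fin m)))
    cliffordCoeff cliffordCoeff_injective

instance (m : ℕ) : NormedSpace ℂ (ComplexClifford m) :=
  NormedSpace.induced ℂ (ComplexClifford m) (EuclideanSpace ℂ (Finset (Fin m))) cliffordCoeff

/-- The conjugation of the Clifford algebra, extended `ℂ`-linearly: the anti-automorphism with
`ē_j = -e_j`. On `e_A` it is the conjugation of the real Clifford algebra. -/
def cliffordBar {m : ℕ} : ComplexClifford m →ₗ[ℂ] ComplexClifford m :=
  (CliffordAlgebra.reverse (Q := cliffordForm m)) ∘ₗ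
    (CliffordAlgebra.involute (Q := cliffordForm m)).toLinearMap

/-- The Hermitian conjugation `(∑_A a_A e_A)† = ∑_A conj(a_A) ē_A`, that is,
`(a + i b)† = ā - i b̄` for `a`, `b` in the real Clifford algebra. -/
def cliffordDagger {m : ℕ} (a : ComplexClifford m) : ComplexClifford m :=
  ∑ A, (starRingEnd ℂ) (cliffordCoeff a A) • cliffordBar (cliffordUnit A)

/-! ### `s`-monogenic functions -/

/-- The Dirac operator `∂_x = ∑ j, e_j ∂_{x_j}` on functions `ℝ^m → ℂ_m`. -/
def diracOp {m : ℕ} (g : (Fin m → ℝ) → ComplexClifford m) : (Fin m → ℝ) → ComplexClifford m :=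
  fun x => ∑ j, cliffordGen j * fderiv ℝ g x (Pi.single j 1)

/-- The complexified Dirac operator `∂_z = ∑ j, e_j ∂_{z_j}` on functions `ℂ^m → ℂ_m`. -/
def complexDiracOp {m : ℕ} (h : (Fin m → ℂ) → ComplexClifford m) :
    (Fin m → ℂ) → ComplexClifford m :=
  fun z => ∑ j, cliffordGen j * fderiv ℂ h z (Pi.single j 1)

/-- The smooth functions on `ℝ^m` in the kernel of `∂_x^s`. -/
def realMonogenic (m s : ℕ) : Set ((Fin m → ℝ) → ComplexClifford m) :=
  {g | ContDiff ℝ (⊤ : ℕ∞) g ∧ diracOp^[s] g = 0}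

/-- The entire functions on `ℂ^m` in the kernel of `∂_z^s`. -/
def complexMonogenic (m s : ℕ) : Set ((Fin m → ℂ) → ComplexClifford m) :=
  {h | Differentiable ℂ h ∧ complexDiracOp^[s] h = 0}

/-! ### The spaces and the transform -/

/-- The functions `f(x) = g(x) e^{-|x|²/4}` with `g` an `s`-monogenic function on `ℝ^m`
that belong to `L²(ℝ^m)`. -/
def monogenicL2 (m s : ℕ) : Set ((Fin m → ℝ) → ComplexClifford m) :=
  {f | (∃ g ∈ realMonogenic m s, f = fun x => Real.exp (-(∑ j, x j ^ 2) / 4) • g x) ∧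
    MemLp f 2 volume}

/-- The Segal-Bargmann-Fock space (module) `B(ℂ^m)`: the entire functions that are
square-integrable with respect to the Gaussian density. -/
def bargmannFock (m : ℕ) : Set ((Fin m → ℂ) → ComplexClifford m) :=
  {h | Differentiable ℂ h ∧
    Integrable (fun z => Real.exp (-∑ j, ‖z j‖ ^ 2) * ‖h z‖ ^ 2) volume}

/-- The `s`-monogenic Bargmann module `MB^s(ℂ^m)`. -/
def monogenicBargmann (m s : ℕ) : Set ((Fin m → ℂ) → ComplexClifford m) :=
  complexMonogenic m s ∩ bargmannFock m

/-- The kernel `exp(-z·z/2 + x·z - x·x/4)`. -/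
def segalBargmannKernel {m : ℕ} (z : Fin m → ℂ) (x : Fin m → ℝ) : ℂ :=
  Complex.exp (-(∑ j, z j * z j) / 2 + (∑ j, (x j : ℂ) * z j)
    - (∑ j, (x j : ℂ) * (x j : ℂ)) / 4)

/-- The Segal-Bargmann transform. -/
def segalBargmann {m : ℕ} (f : (Fin m → ℝ) → ComplexClifford m) :
    (Fin m → ℂ) → ComplexClifford m :=
  fun z => ((2 * Real.pi) ^ ((m : ℝ) / 2))⁻¹ • ∫ x, segalBargmannKernel z x • f x

/-- The `ℂ_m`-valued inner product `(2π)^{-m/2} ∫ f(x)† g(x) dx` on `L²(ℝ^m)`. -/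
def innerL2 {m : ℕ} (f g : (Fin m → ℝ) → ComplexClifford m) : ComplexClifford m :=
  ((2 * Real.pi) ^ ((m : ℝ) / 2))⁻¹ • ∫ x, cliffordDagger (f x) * g x

/-- The `ℂ_m`-valued inner product `π^{-m} ∫ e^{-|z|²} h(z)† k(z) dx dy` on `B(ℂ^m)`. -/
def innerBargmann {m : ℕ} (h k : (Fin m → ℂ) → ComplexClifford m) : ComplexClifford m :=
  (Real.pi ^ m)⁻¹ • ∫ z, Real.exp (-∑ j, ‖z j‖ ^ 2) • (cliffordDagger (h z) * k z)

end

noncomputable section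

namespace SegalBargmann

/-! ### The Clifford algebra as a finite-dimensional normed space -/

/-! Isometry holds on all of L², before any monogenicity enters. For z = x + iy the integral equals
exp(-z·z/2) times the Fourier integral in y of exp(x·t - |t|²/4) f(t). The Bargmann weight times
|exp(-z·z/2)|² is exp(-2|x|²), so Plancherel in y for fixed x, Tonelli, and the Gaussian integral of
exp(-2|x - t/2|²) in x give the norm identity (`lintegral_kernelIntegral_sq`). It is proved for
scalar coefficients. Polarization and expansion in the basis e_A give the Clifford-valued inner
products (`integral_dagger_segalBargmann_mul`), and injectivity follows.

On real points, completing the square turns the transform of g exp(-|x|²/4) into the Gaussian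
average of g, that is, a constant multiple of ∫ exp(-|y|²/2) g(x + y) dy. Averaging commutes with
the Dirac operator. Since only g, and not its derivatives, is controlled at infinity, this is
checked against test functions. An entire function vanishing on ℝ^m is zero, so the transform is
s-monogenic on ℂ^m (`diracOp_iterate_kernelIntegral_eq_zero`).

For surjectivity the heat flow is inverted. As the Dirac operator squares to -Δ, exp(-Δ/2) is the
finite sum of ∂^{2k}/(2^k k!), k < s, on the kernel of ∂^s, and it preserves that kernel. If h has
polynomial growth, a telescoping derivative along the flow shows that the Gaussian average undoes
this sum (`sum_heatCoeff_smul_gaussAverage`); this covers homogeneous components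
(`segalBargmann_preimageFun_homComp`). A general h is the sum of its homogeneous components, which
are orthogonal in Bargmann space by rotation invariance and Parseval on circles
(`lintegral_weight_norm_sq`). The isometry carries the smallness of the tails back to L², and
Fatou's lemma shows that the candidate preimage is square-integrable, is the L² limit of its partial
sums, and maps to h (`memLp_preimageFun`, `segalBargmann_preimageFun`). -/

instance finiteDimensional_complexClifford (m : ℕ) : FiniteDimensional ℂ (ComplexClifford m) :=
  Module.Finite.of_basis (cliffordBasis m)

instance finiteDimensional_real_complexClifford (m : ℕ) :
    FiniteDimensional ℝ (ComplexClifford m) :=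
  Module.Finite.trans ℂ (ComplexClifford m)

instance completeSpace_complexClifford (m : ℕ) : CompleteSpace (ComplexClifford m) :=
  FiniteDimensional.complete ℂ (ComplexClifford m)

/-- The coefficient functional `a ↦ a_A`. -/
def coeffCLM {m : ℕ} (A : Finset (Fin m)) : ComplexClifford m →L[ℂ] ℂ :=
  LinearMap.toContinuousLinearMap ((EuclideanSpace.proj A).toLinearMap ∘ₗ cliffordCoeff)

@[simp]
theorem coeffCLM_apply {m : ℕ} (A : Finset (Fin m)) (a : ComplexClifford m) :
    coeffCLM A a = cliffordCoeff a A := rfl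

theorem norm_sq_eq_sum_coeff {m : ℕ} (a : ComplexClifford m) :
    ‖a‖ ^ 2 = ∑ A, ‖coeffCLM A a‖ ^ 2 :=
  EuclideanSpace.norm_sq_eq (cliffordCoeff a)

/-- Multiplication from the left as a continuous linear map. -/
def leftMul {m : ℕ} (a : ComplexClifford m) : ComplexClifford m →L[ℂ] ComplexClifford m :=
  LinearMap.toContinuousLinearMap (LinearMap.mulLeft ℂ a)

@[simp]
theorem leftMul_apply {m : ℕ} (a b : ComplexClifford m) : leftMul a b = a * b := rfl

/-- Multiplication from the right as a continuous linear map. -/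
def rightMul {m : ℕ} (a : ComplexClifford m) : ComplexClifford m →L[ℂ] ComplexClifford m :=
  LinearMap.toContinuousLinearMap (LinearMap.mulRight ℂ a)

@[simp]
theorem rightMul_apply {m : ℕ} (a b : ComplexClifford m) : rightMul a b = b * a := rfl

/-- Every Clifford-valued inner product is thereby a finite combination, with constant Clifford
coefficients, of scalar integrals of a conjugate times a function. -/
theorem dagger_mul_eq_sum {m : ℕ} (a b : ComplexClifford m) :
    cliffordDagger a * b = ∑ A, ∑ B, ((starRingEnd ℂ) (coeffCLM A a) * coeffCLM B b) •
      (cliffordBar (cliffordUnit A) * cliffordUnit B) := by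
  conv_lhs => rw [← sum_cliffordCoeff b]
  rw [cliffordDagger, Finset.sum_mul]
  simp only [Finset.mul_sum, coeffCLM_apply]
  refine Finset.sum_congr rfl fun A _ => Finset.sum_congr rfl fun B _ => ?_
  rw [smul_mul_assoc, mul_smul_comm, smul_smul]

/-! ### Entire functions of several variables -/

section Entire

variable {V E : Type*} [NormedAddCommGroup V] [NormedSpace ℂ V]
  [NormedAddCommGroup E] [NormedSpace ℂ E]

theorem hasDerivAt_comp_line {h : V → E} (hh : Differentiable ℂ h) (z v : V) (t : ℂ) :
    HasDerivAt (fun t : ℂ => h (z + t • v)) (fderiv ℂ h (z + t • v) v) t := by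
  have hline : HasDerivAt (fun t : ℂ => z + t • v) v t := by
    simpa using ((hasDerivAt_id t).smul_const v).const_add z
  exact (hh (z + t • v)).hasFDerivAt.comp_hasDerivAt t hline

/-- Cauchy's estimate on the unit circle of each complex line through p. It bounds the derivative
locally without assuming that the derivative is continuous. -/
theorem norm_fderiv_le_of_forall_closedBall {h : V → E} (hh : Differentiable ℂ h) {R M : ℝ}
    (hM : ∀ q, ‖q‖ ≤ R + 1 → ‖h q‖ ≤ M) {p : V} (hp : ‖p‖ ≤ R) : ‖fderiv ℂ h p‖ ≤ M := by
  have hM0 : 0 ≤ M := (norm_nonneg _).trans (hM p (by linarith))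
  refine ContinuousLinearMap.opNorm_le_of_unit_norm (𝕜 := ℂ) hM0 fun v hv => ?_
  have hder := hasDerivAt_comp_line hh p v 0
  rw [zero_smul, add_zero] at hder
  have hd : Differentiable ℂ fun t : ℂ => h (p + t • v) := fun t =>
    (hasDerivAt_comp_line hh p v t).differentiableAt
  have := Complex.norm_deriv_le_of_forall_mem_sphere_norm_le (f := fun t : ℂ => h (p + t • v))
    (c := 0) (R := 1) (C := M) one_pos hd.diffContOnCl fun t ht => hM _ ?_
  · rwa [hder.deriv, div_one] at this
  · have ht' : ‖t‖ = 1 := by simpa using ht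
    calc ‖p + t • v‖ ≤ ‖p‖ + ‖t • v‖ := norm_add_le _ _
      _ ≤ R + 1 := by rw [norm_smul, ht', hv]; linarith

variable [FiniteDimensional ℂ V] [FiniteDimensional ℂ E]

/-- Differentiation under the integral in the generality needed twice: c = 1 with w running over a
circle gives Cauchy's formula for a directional derivative, and c = exp(iθ) with w = 0 gives
homogeneous components. -/
theorem hasFDerivAt_integral_smul_comp {h : V → E} (hh : Differentiable ℂ h) {φ c : ℝ → ℂ}
    {w : ℝ → V} (hφ : Continuous φ) (hc : Continuous c) (hw : Continuous w) (a b : ℝ) (z : V) :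
    HasFDerivAt (fun z => ∫ θ in a..b, φ θ • h (c θ • z + w θ))
      (∫ θ in a..b, (φ θ * c θ) • fderiv ℂ h (c θ • z + w θ)) z := by
  have : ProperSpace V := FiniteDimensional.proper ℂ V
  have : CompleteSpace E := FiniteDimensional.complete ℂ E
  have : ProperSpace (V →L[ℂ] E) := FiniteDimensional.proper ℂ (V →L[ℂ] E)
  let _ : MeasurableSpace V := borel V
  have : BorelSpace V := ⟨rfl⟩
  have hcont : Continuous fun p : V × ℝ => c p.2 • p.1 + w p.2 := by fun_prop
  obtain ⟨R, hR⟩ : ∃ R, ∀ p ∈ Metric.closedBall z 1 ×ˢ Set.uIcc a b,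
      ‖c p.2 • p.1 + w p.2‖ ≤ R :=
    ((isCompact_closedBall z 1).prod isCompact_uIcc).exists_bound_of_continuousOn
      hcont.continuousOn
  obtain ⟨M, hM⟩ := (isCompact_closedBall (0 : V) (R + 1)).exists_bound_of_continuousOn
    hh.continuous.continuousOn
  have hM' : ∀ q : V, ‖q‖ ≤ R + 1 → ‖h q‖ ≤ M := fun q hq => hM q (by simpa using hq)
  have hint : ∀ z : V, Continuous fun θ => φ θ • h (c θ • z + w θ) := fun z => by
    have := hh.continuous
    fun_prop
  refine intervalIntegral.hasFDerivAt_integral_of_dominated_of_fderiv_le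
    (F := fun z θ => φ θ • h (c θ • z + w θ))
    (F' := fun z θ => (φ θ * c θ) • fderiv ℂ h (c θ • z + w θ))
    (bound := fun θ => ‖φ θ * c θ‖ * M) (Metric.ball_mem_nhds z one_pos)
    (Filter.Eventually.of_forall fun z => (hint z).aestronglyMeasurable)
    ((hint z).intervalIntegrable _ _) ?_ ?_ ?_ ?_
  · refine AEStronglyMeasurable.smul (hφ.mul hc).aestronglyMeasurable ?_
    -- Continuity of the derivative is a later consequence of this lemma, so only its measurability
    -- may be used here.
    have h1 : StronglyMeasurable (fderiv ℂ h) := by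
      let _ : MeasurableSpace (V →L[ℂ] E) := borel _
      have : BorelSpace (V →L[ℂ] E) := ⟨rfl⟩
      exact (measurable_fderiv ℂ h).stronglyMeasurable
    exact (h1.comp_measurable (by fun_prop : Continuous fun θ => c θ • z + w θ).measurable).aestronglyMeasurable
  · refine Filter.Eventually.of_forall fun θ hθ y hy => ?_
    rw [norm_smul]
    refine mul_le_mul_of_nonneg_left (norm_fderiv_le_of_forall_closedBall hh hM' ?_)
      (norm_nonneg _)
    exact hR (y, θ) ⟨Metric.ball_subset_closedBall hy, Set.uIoc_subset_uIcc hθ⟩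
  · exact (by fun_prop : Continuous fun θ => ‖φ θ * c θ‖ * M).intervalIntegrable _ _
  · refine Filter.Eventually.of_forall fun θ _ y _ => ?_
    have h1 : HasFDerivAt (fun y : V => c θ • y + w θ) (c θ • ContinuousLinearMap.id ℂ V) y :=
      ((hasFDerivAt_id y).const_smul (c θ)).add_const _
    have h2 := ((hh (c θ • y + w θ)).hasFDerivAt.comp y h1).const_smul (φ θ)
    refine h2.congr_fderiv ?_
    ext v
    simp [smul_smul]

/-- By Cauchy's formula on the line z + tv, the directional derivative is a circle average of h over
translates of z, and such an average is differentiable in z. Iterating this gives smoothness in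
several variables. -/
theorem differentiable_fderiv_apply {h : V → E} (hh : Differentiable ℂ h) (v : V) :
    Differentiable ℂ fun z => fderiv ℂ h z v := by
  have : CompleteSpace E := FiniteDimensional.complete ℂ E
  have hd : ∀ z, Differentiable ℂ fun t : ℂ => h (z + t • v) := fun z t =>
    (hasDerivAt_comp_line hh z v t).differentiableAt
  have key : (fun z => fderiv ℂ h z v) = fun z => (2 * Real.pi * Complex.I : ℂ)⁻¹ •
      ∫ θ in (0 : ℝ)..2 * Real.pi, (deriv (circleMap 0 1) θ * (circleMap 0 1 θ ^ 2)⁻¹) •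
        h ((1 : ℂ) • z + circleMap 0 1 θ • v) := by
    funext z
    have h1 := Complex.two_pi_I_inv_smul_circleIntegral_sub_sq_inv_smul_of_differentiable
      (f := fun t : ℂ => h (z + t • v)) isOpen_univ (Set.subset_univ (Metric.closedBall 0 1))
      (hd z).differentiableOn (w₀ := 0) (by simp)
    have hder := hasDerivAt_comp_line hh z v 0
    rw [zero_smul, add_zero] at hder
    rw [hder.deriv] at h1
    rw [← h1]
    simp [circleIntegral, smul_smul]
  rw [key]
  intro z
  refine DifferentiableAt.const_smul ?_ _
  refine (hasFDerivAt_integral_smul_comp hh (c := fun _ => 1) ?_ continuous_const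
    (by fun_prop) _ _ z).differentiableAt
  simp only [deriv_circleMap]
  refine Continuous.mul (by fun_prop) (Continuous.inv₀ (by fun_prop) fun θ => ?_)
  exact pow_ne_zero _ (circleMap_ne_center one_ne_zero)

theorem contDiff_of_differentiable {h : V → E} (hh : Differentiable ℂ h) :
    ContDiff ℂ (⊤ : ℕ∞) h := by
  refine contDiff_infty.2 fun n => ?_
  induction n generalizing h with
  | zero => exact contDiff_zero.2 hh.continuous
  | succ n ih =>
    push_cast
    refine contDiff_succ_iff_fderiv_apply.2 ⟨hh, by simp, fun v => ?_⟩
    exact ih (differentiable_fderiv_apply hh v)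

end Entire

/-- An entire function on `ℂ^m` vanishing on `ℝ^m` vanishes. -/
theorem eq_zero_of_real_eq_zero {m : ℕ} {E : Type*} [NormedAddCommGroup E] [NormedSpace ℂ E]
    [CompleteSpace E] {h : (Fin m → ℂ) → E} (hh : Differentiable ℂ h)
    (h0 : ∀ x : Fin m → ℝ, h (fun j => (x j : ℂ)) = 0) : h = 0 := by
  funext z
  -- The complex line γ takes real values at real t and passes through z at t = i. The one-variable
  -- identity theorem, applied along t = 1/(n+1), then gives the vanishing at z.
  let γ : ℂ → Fin m → ℂ := fun t j => ((z j).re : ℂ) + t * ((z j).im : ℂ)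
  have hγ : Differentiable ℂ γ := by
    rw [differentiable_pi]
    intro j
    fun_prop
  have hd : AnalyticOnNhd ℂ (fun t => h (γ t)) Set.univ :=
    (hh.comp hγ).differentiableOn.analyticOnNhd isOpen_univ
  have hz : AnalyticOnNhd ℂ (fun _ : ℂ => (0 : E)) Set.univ := analyticOnNhd_const
  have hfreq : ∃ᶠ t in nhdsWithin (0 : ℂ) {0}ᶜ, h (γ t) = 0 := by
    have hlim : Filter.Tendsto (fun n : ℕ => (1 / ((n : ℂ) + 1))) Filter.atTop
        (nhdsWithin 0 {0}ᶜ) :=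
      tendsto_nhdsWithin_iff.2 ⟨tendsto_one_div_add_atTop_nhds_zero_nat,
        Filter.Eventually.of_forall fun n => one_div_ne_zero (Nat.cast_add_one_ne_zero n)⟩
    refine hlim.frequently (Filter.Frequently.of_forall fun n => ?_)
    rw [← h0 fun j => (z j).re + (1 / ((n : ℝ) + 1)) * (z j).im]
    congr 1
    funext j
    simp [γ]
  have := congrFun (hd.eq_of_frequently_eq hz hfreq) Complex.I
  have hI : γ Complex.I = z := by
    funext j
    simp only [γ]
    rw [mul_comm, Complex.re_add_im]
  simpa [hI] using this

/-! ### The Segal-Bargmann integral of a square-integrable function -/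

section Kernel

variable {m : ℕ}

theorem memLp_exp_sub_sq (a : ℝ) :
    MemLp (fun x : Fin m → ℝ => Real.exp (a * ∑ j, |x j| - (∑ j, x j ^ 2) / 4)) 2 := by
  have hc : Continuous fun x : Fin m → ℝ => Real.exp (a * ∑ j, |x j| - (∑ j, x j ^ 2) / 4) := by
    fun_prop
  rw [memLp_two_iff_integrable_sq hc.aestronglyMeasurable]
  have h1 : Integrable fun t : ℝ => Real.exp (2 * a * |t| - t ^ 2 / 2) := by
    refine ((integrable_exp_neg_mul_sq (b := 1 / 4) (by norm_num)).const_mul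
      (Real.exp (4 * a ^ 2))).mono' (by fun_prop) (Filter.Eventually.of_forall fun t => ?_)
    rw [Real.norm_eq_abs, Real.abs_exp, ← Real.exp_add]
    refine Real.exp_le_exp.2 ?_
    -- Completing the square: 2a|t| - t²/2 ≤ 4a² - t²/4.
    have := sq_nonneg (|t| / 2 - 2 * a)
    nlinarith [sq_abs t]
  have h2 := Integrable.fintype_prod (ι := Fin m) (f := fun _ t => Real.exp (2 * a * |t| - t ^ 2 / 2))
    (μ := fun _ => volume) fun _ => h1
  refine h2.congr (Filter.Eventually.of_forall fun x => ?_)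
  simp only [← Real.exp_sum, Finset.sum_sub_distrib, ← Finset.mul_sum, ← Finset.sum_div]
  rw [← Real.exp_nat_mul]
  congr 1
  push_cast
  ring

/-- Since ‖z‖ is the sup norm, |z·z| ≤ mR². The uniformity in z is what makes the bound usable for
domination as well as for membership in L². -/
theorem norm_segalBargmannKernel_le {z : Fin m → ℂ} {R : ℝ} (hz : ‖z‖ ≤ R) (x : Fin m → ℝ) :
    ‖segalBargmannKernel z x‖ ≤
      Real.exp (m * R ^ 2 / 2) * Real.exp (R * ∑ j, |x j| - (∑ j, x j ^ 2) / 4) := by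
  have hR : 0 ≤ R := (norm_nonneg z).trans hz
  have hzj : ∀ j, ‖z j‖ ≤ R := fun j => (norm_le_pi_norm z j).trans hz
  rw [segalBargmannKernel, Complex.norm_exp, ← Real.exp_add]
  refine Real.exp_le_exp.2 ?_
  have h1 : (-(∑ j, z j * z j)).re ≤ m * R ^ 2 := by
    refine (Complex.re_le_norm _).trans ?_
    rw [norm_neg]
    calc ‖∑ j, z j * z j‖ ≤ ∑ j : Fin m, R ^ 2 := by
          refine norm_sum_le_of_le _ fun j _ => ?_
          rw [norm_mul, sq]
          exact mul_le_mul (hzj j) (hzj j) (norm_nonneg _) hR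
      _ = m * R ^ 2 := by simp
  have h2 : (∑ j, (x j : ℂ) * z j).re ≤ R * ∑ j, |x j| := by
    refine (Complex.re_le_norm _).trans ?_
    rw [Finset.mul_sum]
    refine norm_sum_le_of_le _ fun j _ => ?_
    rw [norm_mul, Complex.norm_real, Real.norm_eq_abs, mul_comm]
    exact mul_le_mul_of_nonneg_right (hzj j) (abs_nonneg _)
  have h3 : (∑ j, (x j : ℂ) * (x j : ℂ)) = ((∑ j, x j ^ 2 : ℝ) : ℂ) := by
    push_cast
    simp only [sq]
  have h4 : ((-(∑ j, z j * z j)) / 2).re = (-(∑ j, z j * z j)).re / 2 := by simp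
  have h5 : ((∑ j, (x j : ℂ) * (x j : ℂ)) / 4).re = (∑ j, x j ^ 2) / 4 := by
    rw [h3]
    exact_mod_cast Complex.ofReal_re _
  rw [Complex.sub_re, Complex.add_re, h4, h5]
  linarith

theorem continuous_segalBargmannKernel (z : Fin m → ℂ) :
    Continuous fun x : Fin m → ℝ => segalBargmannKernel z x := by
  unfold segalBargmannKernel
  fun_prop

theorem memLp_segalBargmannKernel (z : Fin m → ℂ) : MemLp (segalBargmannKernel z) 2 :=
  ((memLp_exp_sub_sq ‖z‖).const_mul (Real.exp (m * ‖z‖ ^ 2 / 2))).mono'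
    (continuous_segalBargmannKernel z).aestronglyMeasurable
    (Filter.Eventually.of_forall fun x => norm_segalBargmannKernel_le le_rfl x)

theorem hasFDerivAt_segalBargmannKernel (z : Fin m → ℂ) (x : Fin m → ℝ) :
    HasFDerivAt (fun z => segalBargmannKernel z x)
      (∑ j, (segalBargmannKernel z x * ((x j : ℂ) - z j)) •
        (ContinuousLinearMap.proj j : (Fin m → ℂ) →L[ℂ] ℂ)) z := by
  have hp : ∀ j, HasFDerivAt (fun z : Fin m → ℂ => z j)
      (ContinuousLinearMap.proj j : (Fin m → ℂ) →L[ℂ] ℂ) z := fun j => hasFDerivAt_apply j z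
  have h1 : HasFDerivAt (fun z : Fin m → ℂ => ∑ j, z j * z j)
      (∑ j, (z j • (ContinuousLinearMap.proj j : (Fin m → ℂ) →L[ℂ] ℂ) +
        z j • (ContinuousLinearMap.proj j : (Fin m → ℂ) →L[ℂ] ℂ))) z :=
    HasFDerivAt.fun_sum fun j _ => (hp j).mul (hp j)
  have h2 : HasFDerivAt (fun z : Fin m → ℂ => ∑ j, (x j : ℂ) * z j)
      (∑ j, (x j : ℂ) • (ContinuousLinearMap.proj j : (Fin m → ℂ) →L[ℂ] ℂ)) z :=
    HasFDerivAt.fun_sum fun j _ => (hp j).const_mul (x j : ℂ)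
  have h3 := (((h1.neg.mul_const (2⁻¹ : ℂ)).add h2).sub_const
    ((∑ j, (x j : ℂ) * (x j : ℂ)) / 4)).cexp
  refine (h3.congr_fderiv ?_).congr_of_eventuallyEq (Filter.Eventually.of_forall fun w => ?_)
  · ext v
    simp only [segalBargmannKernel, smul_apply, add_apply,
      neg_apply, sum_apply, ContinuousLinearMap.proj_apply,
      smul_eq_mul, Pi.add_apply, Pi.neg_apply]
    rw [← div_eq_mul_inv]
    simp only [mul_assoc, sub_mul, ← Finset.mul_sum, Finset.sum_sub_distrib,
      Finset.sum_add_distrib]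
    ring
  · simp [segalBargmannKernel, div_eq_mul_inv]

variable {E : Type*} [NormedAddCommGroup E] [NormedSpace ℂ E]

theorem integrable_segalBargmannKernel_smul {f : (Fin m → ℝ) → E} (hf : MemLp f 2)
    (z : Fin m → ℂ) : Integrable fun x => segalBargmannKernel z x • f x :=
  memLp_one_iff_integrable.1 (hf.smul (memLp_segalBargmannKernel z))

/-- The integral defining the Segal-Bargmann transform, without its prefactor and with values in
an arbitrary space. -/
def kernelIntegral (f : (Fin m → ℝ) → E) (z : Fin m → ℂ) : E :=
  ∫ x, segalBargmannKernel z x • f x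

theorem differentiable_kernelIntegral [CompleteSpace E] {f : (Fin m → ℝ) → E} (hf : MemLp f 2) :
    Differentiable ℂ (kernelIntegral f) := by
  intro z₀
  set R : ℝ := ‖z₀‖ + 1
  have hRz : ∀ z ∈ Metric.ball z₀ 1, ‖z‖ ≤ R := fun z hz => by
    have := norm_le_norm_add_norm_sub' z z₀
    rw [mem_ball_iff_norm] at hz
    simp only [R]
    linarith
  have hR0 : 0 ≤ R := by positivity
  refine HasFDerivAt.differentiableAt (hasFDerivAt_integral_of_dominated_of_fderiv_le
    (F := fun z x => segalBargmannKernel z x • f x)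
    (F' := fun z x => ∑ j, (ContinuousLinearMap.proj j : (Fin m → ℂ) →L[ℂ] ℂ).smulRight
      ((segalBargmannKernel z x * ((x j : ℂ) - z j)) • f x))
    -- Differentiating in z_j brings down x_j - z_j, of size at most |x_j| + R. The sum of these is
    -- at most (1 + mR) exp(∑|x_j|), which raises the exponent from R to R + 1.
    (bound := fun x => (Real.exp (m * R ^ 2 / 2) * (1 + m * R)) *
      (Real.exp ((R + 1) * ∑ j, |x j| - (∑ j, x j ^ 2) / 4) * ‖f x‖))
    (Metric.ball_mem_nhds z₀ one_pos)
    (Filter.Eventually.of_forall fun z =>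
      (integrable_segalBargmannKernel_smul hf z).aestronglyMeasurable)
    (integrable_segalBargmannKernel_smul hf z₀) ?_ ?_ ?_ ?_)
  · refine Finset.aestronglyMeasurable_fun_sum _ fun j _ => ?_
    refine (ContinuousLinearMap.smulRightL ℂ (Fin m → ℂ) E
      (ContinuousLinearMap.proj j)).continuous.comp_aestronglyMeasurable ?_
    refine AEStronglyMeasurable.smul (Continuous.aestronglyMeasurable ?_) hf.aestronglyMeasurable
    exact (continuous_segalBargmannKernel z₀).mul (by fun_prop)
  · refine Filter.Eventually.of_forall fun x z hz => ?_
    have hz' := hRz z hz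
    have h1 : ∀ j, ‖(x j : ℂ) - z j‖ ≤ |x j| + R := fun j => by
      refine (norm_sub_le _ _).trans (add_le_add (by simp) ((norm_le_pi_norm z j).trans hz'))
    have hS : 0 ≤ ∑ j, |x j| := Finset.sum_nonneg fun j _ => abs_nonneg _
    have h2 : ∑ j : Fin m, (|x j| + R) ≤ (1 + m * R) * Real.exp (∑ j, |x j|) := by
      rw [Finset.sum_add_distrib]
      simp only [Finset.sum_const, Finset.card_univ, Fintype.card_fin, nsmul_eq_mul]
      have h3 := Real.add_one_le_exp (∑ j, |x j|)
      have h4 : 0 ≤ (m : ℝ) * R := by positivity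
      nlinarith [mul_nonneg h4 hS]
    calc _ ≤ ∑ j, ‖segalBargmannKernel z x‖ * (|x j| + R) * ‖f x‖ := by
          refine norm_sum_le_of_le _ fun j _ => ?_
          rw [ContinuousLinearMap.norm_smulRight_apply, norm_smul, norm_mul]
          have hp : ‖(ContinuousLinearMap.proj j : (Fin m → ℂ) →L[ℂ] ℂ)‖ ≤ 1 :=
            ContinuousLinearMap.opNorm_le_bound _ zero_le_one fun v => by
              simpa using norm_le_pi_norm v j
          refine (mul_le_of_le_one_left (by positivity) hp).trans ?_
          gcongr
          exact h1 j
      _ = ‖segalBargmannKernel z x‖ * (∑ j, (|x j| + R)) * ‖f x‖ := by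
          rw [Finset.mul_sum, Finset.sum_mul]
      _ ≤ (Real.exp (m * R ^ 2 / 2) * Real.exp (R * ∑ j, |x j| - (∑ j, x j ^ 2) / 4)) *
            ((1 + m * R) * Real.exp (∑ j, |x j|)) * ‖f x‖ := by
          gcongr
          exact norm_segalBargmannKernel_le hz' x
      _ = _ := by
          rw [show (R + 1) * ∑ j, |x j| - (∑ j, x j ^ 2) / 4 =
            (R * ∑ j, |x j| - (∑ j, x j ^ 2) / 4) + ∑ j, |x j| by ring, Real.exp_add]
          ring
  · exact (memLp_one_iff_integrable.1 (hf.norm.smul (memLp_exp_sub_sq (R + 1)))).const_mul _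
  · refine Filter.Eventually.of_forall fun x z _ => ?_
    refine ((hasFDerivAt_segalBargmannKernel z x).smul_const (f x)).congr_fderiv ?_
    ext v
    simp [Finset.sum_smul, smul_smul, mul_comm]

end Kernel

/-! ### The Plancherel theorem for integrable square-integrable functions -/

section Plancherel

open FourierTransform SchwartzMap

variable {V : Type*} [NormedAddCommGroup V] [InnerProductSpace ℝ V] [FiniteDimensional ℝ V]
  [MeasurableSpace V] [BorelSpace V]

theorem continuous_fourier_of_integrable {F : V → ℂ} (hF : Integrable F) : Continuous (𝓕 F) :=
  VectorFourier.fourierIntegral_continuous Real.continuous_fourierChar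
    (by exact continuous_inner) hF

/-- The L² transform is characterized by its pairing with Schwartz functions, and the Fourier
integral of an integrable function has the same pairing by Fubini. The two therefore agree as
distributions, hence almost everywhere. -/
theorem fourier_toLp_ae_eq {F : V → ℂ} (h1 : Integrable F) (h2 : MemLp F 2) :
    (𝓕 (h2.toLp F) : Lp ℂ 2 (volume : Measure V)) =ᵐ[volume] 𝓕 F := by
  refine ae_eq_of_integral_contDiff_smul_eq ((Lp.memLp _).locallyIntegrable one_le_two)
    (continuous_fourier_of_integrable h1).locallyIntegrable fun g hg hgc => ?_
  have hg1 : HasCompactSupport (Complex.ofRealCLM ∘ g) := hgc.comp_left rfl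
  have hg2 : ContDiff ℝ (⊤ : ℕ∞) (Complex.ofRealCLM ∘ g) := by fun_prop
  set φ : 𝓢(V, ℂ) := hg1.toSchwartzMap hg2 with hφ
  have hφg : ∀ x, φ x = (g x : ℂ) := fun x => rfl
  have e1 := congrArg (fun T => T φ) (Lp.fourier_toTemperedDistribution_eq (h2.toLp F))
  simp only [TemperedDistribution.fourier_apply, Lp.toTemperedDistribution_apply] at e1
  have e2 : ∫ x, (𝓕 φ) x • (h2.toLp F) x = ∫ x, (𝓕 φ) x • F x := by
    refine integral_congr_ae ?_
    filter_upwards [h2.coeFn_toLp] with x hx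
    rw [hx]
  have e3 : ∫ x, (𝓕 φ) x • F x = ∫ x, φ x • (𝓕 F) x := by
    have := VectorFourier.integral_fourierIntegral_smul_eq_flip (μ := (volume : Measure V))
      (ν := (volume : Measure V)) (L := innerₗ V) (f := φ) (g := F)
      Real.continuous_fourierChar continuous_inner φ.integrable h1
    rw [flip_innerₗ] at this
    simpa [SchwartzMap.fourier_coe] using! this
  have e4 := e1.symm.trans (e2.trans e3)
  simpa [hφg] using e4

theorem lintegral_fourier_sq {F : V → ℂ} (h1 : Integrable F) (h2 : MemLp F 2) :
    ∫⁻ ξ, ‖𝓕 F ξ‖ₑ ^ 2 = ∫⁻ x, ‖F x‖ₑ ^ 2 := by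
  have key : ∀ f : Lp ℂ 2 (volume : Measure V), ∫⁻ x, ‖f x‖ₑ ^ 2 = ENNReal.ofReal ‖f‖ ^ 2 := by
    intro f
    rw [ofReal_norm, Lp.enorm_def, eLpNorm_eq_lintegral_rpow_enorm_toReal (by simp) (by simp)]
    rw [← ENNReal.rpow_natCast, ← ENNReal.rpow_mul]
    simp
  calc ∫⁻ ξ, ‖𝓕 F ξ‖ₑ ^ 2 = ∫⁻ ξ, ‖(𝓕 (h2.toLp F) : Lp ℂ 2 (volume : Measure V)) ξ‖ₑ ^ 2 := by
        refine lintegral_congr_ae ?_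
        filter_upwards [fourier_toLp_ae_eq h1 h2] with x hx
        rw [hx]
    _ = ∫⁻ ξ, ‖(h2.toLp F) ξ‖ₑ ^ 2 := by rw [key, key, Lp.norm_fourier_eq]
    _ = _ := by
        refine lintegral_congr_ae ?_
        filter_upwards [h2.coeFn_toLp] with x hx
        rw [hx]

/-- The Plancherel theorem on `ℝ^m`, in the normalization without `2π` in the exponent. -/
theorem lintegral_integral_exp_I_sq {m : ℕ} {w : (Fin m → ℝ) → ℂ} (h1 : Integrable w)
    (h2 : MemLp w 2) :
    ∫⁻ y : Fin m → ℝ, ‖∫ t, Complex.exp (Complex.I * ∑ j, (t j : ℂ) * (y j : ℂ)) * w t‖ₑ ^ 2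
      = ENNReal.ofReal ((2 * Real.pi) ^ m) * ∫⁻ t, ‖w t‖ₑ ^ 2 := by
  have hpres := PiLp.volume_preserving_ofLp (Fin m)
  have hemb : MeasurableEmbedding (@WithLp.ofLp 2 (Fin m → ℝ)) :=
    (MeasurableEquiv.toLp 2 (Fin m → ℝ)).symm.measurableEmbedding
  set W : EuclideanSpace ℝ (Fin m) → ℂ := fun t => w t.ofLp with hW
  have hW1 : Integrable W := (hpres.integrable_comp_emb hemb).2 h1
  have hW2 : MemLp W 2 := h2.comp_measurePreserving hpres
  set G : (Fin m → ℝ) → ENNReal :=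
    fun y => ‖∫ t, Complex.exp (Complex.I * ∑ j, (t j : ℂ) * (y j : ℂ)) * w t‖ₑ ^ 2 with hG
  have hpl := lintegral_fourier_sq hW1 hW2
  -- The substitution y = -2πξ converts the kernel exp(-2πi t·ξ) into exp(i t·y); its Jacobian is
  -- the source of (2π)^m.
  have hF : ∀ ξ, ‖𝓕 W ξ‖ₑ ^ 2 = G ((-(2 * Real.pi)) • ξ.ofLp) := by
    intro ξ
    rw [hG, Real.fourier_eq']
    simp only
    congr 2
    rw [← hpres.integral_comp hemb]
    refine integral_congr_ae (Filter.Eventually.of_forall fun t => ?_)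
    simp only [smul_eq_mul, hW]
    congr 2
    simp only [PiLp.inner_apply, RCLike.inner_apply, conj_trivial, Pi.smul_apply, smul_eq_mul]
    push_cast
    rw [Finset.mul_sum, Finset.sum_mul, Finset.mul_sum]
    refine Finset.sum_congr rfl fun j _ => ?_
    ring
  have hr : (-(2 * Real.pi)) ≠ 0 := by simp [Real.pi_ne_zero]
  have hscale : ∫⁻ y, G ((-(2 * Real.pi)) • y) = ENNReal.ofReal ((2 * Real.pi) ^ m)⁻¹ * ∫⁻ y, G y := by
    have := lintegral_map_equiv (μ := (volume : Measure (Fin m → ℝ))) G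
      (Homeomorph.smulOfNeZero (α := Fin m → ℝ) _ hr).toMeasurableEquiv
    have h3 : (⇑(Homeomorph.smulOfNeZero (α := Fin m → ℝ) _ hr).toMeasurableEquiv)
      = fun y : Fin m → ℝ => (-(2 * Real.pi)) • y := rfl
    rw [h3] at this
    rw [← this, Measure.map_addHaar_smul _ hr, lintegral_smul_measure]
    simp [abs_inv, abs_pow, abs_of_pos Real.pi_pos]
  rw [lintegral_congr hF, hpres.lintegral_comp_emb hemb (fun y => G ((-(2 * Real.pi)) • y)),
    hscale, hW, hpres.lintegral_comp_emb hemb (fun t => ‖w t‖ₑ ^ 2)] at hpl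
  rw [← hpl, ← mul_assoc, ← ENNReal.ofReal_mul (by positivity),
    mul_inv_cancel₀ (by positivity), ENNReal.ofReal_one, one_mul]

end Plancherel

/-! ### The Segal-Bargmann integral is isometric -/

section Isometry

variable {m : ℕ}

theorem lintegral_exp_neg_two_mul_sq (t : Fin m → ℝ) :
    ∫⁻ x : Fin m → ℝ, ENNReal.ofReal (Real.exp (-2 * ∑ j, (x j - t j / 2) ^ 2))
      = ENNReal.ofReal (Real.sqrt (Real.pi / 2) ^ m) := by
  have h1 := lintegral_sub_right_eq_self (μ := (volume : Measure (Fin m → ℝ)))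
    (fun x => ENNReal.ofReal (Real.exp (-2 * ∑ j, x j ^ 2))) (fun j => t j / 2)
  simp only [Pi.sub_apply] at h1
  have h2 : ∀ x : Fin m → ℝ, Real.exp (-2 * ∑ j, x j ^ 2) = ∏ j, Real.exp (-2 * x j ^ 2) := by
    intro x
    rw [Finset.mul_sum, Real.exp_sum]
  have hint : Integrable fun x : Fin m → ℝ => Real.exp (-2 * ∑ j, x j ^ 2) := by
    simp only [h2]
    exact Integrable.fintype_prod (f := fun _ t => Real.exp (-2 * t ^ 2))
      (μ := fun _ => volume) fun _ => integrable_exp_neg_mul_sq two_pos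
  rw [h1, ← ofReal_integral_eq_lintegral_ofReal hint
    (Filter.Eventually.of_forall fun x => (Real.exp_pos _).le)]
  simp only [h2]
  rw [integral_fintype_prod_volume_eq_pow (fun t : ℝ => Real.exp (-2 * t ^ 2)),
    integral_gaussian, Fintype.card_fin]

theorem lintegral_complex_pi (G : (Fin m → ℂ) → ENNReal) (hG : Measurable G) :
    ∫⁻ z, G z = ∫⁻ x : Fin m → ℝ, ∫⁻ y : Fin m → ℝ,
      G (fun j => (x j : ℂ) + (y j : ℂ) * Complex.I) := by
  let e : (Fin m → ℂ) ≃ᵐ (Fin m → ℝ) × (Fin m → ℝ) :=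
    (MeasurableEquiv.piCongrRight fun _ => Complex.measurableEquivRealProd).trans
      (MeasurableEquiv.arrowProdEquivProdArrow ℝ ℝ (Fin m))
  have he : MeasurePreserving e volume volume :=
    (volume_measurePreserving_arrowProdEquivProdArrow ℝ ℝ (Fin m)).comp
      (volume_preserving_pi fun _ => Complex.volume_preserving_equiv_real_prod)
  have h1 := he.symm.lintegral_comp_emb e.symm.measurableEmbedding G
  rw [← h1, Measure.volume_eq_prod,
    lintegral_prod (fun p => G (e.symm p)) (hG.comp e.symm.measurable).aemeasurable]
  refine lintegral_congr fun x => lintegral_congr fun y => ?_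
  congr 1
  apply e.injective
  rw [e.apply_symm_apply]
  refine Prod.ext (funext fun j => ?_) (funext fun j => ?_)
  · change x j = ((x j : ℂ) + (y j : ℂ) * Complex.I).re
    simp
  · change y j = ((x j : ℂ) + (y j : ℂ) * Complex.I).im
    simp

/-- The function whose Fourier transform is the slice of the Segal-Bargmann integral over
real part `x`. -/
def sliceFun (u : (Fin m → ℝ) → ℂ) (x t : Fin m → ℝ) : ℂ :=
  (Real.exp (∑ j, x j * t j - (∑ j, t j ^ 2) / 4) : ℂ) * u t

theorem integrable_sliceFun {u : (Fin m → ℝ) → ℂ} (hu : MemLp u 2) (x : Fin m → ℝ) :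
    Integrable (sliceFun u x) := by
  refine ((integrable_segalBargmannKernel_smul hu fun j => (x j : ℂ)).const_mul
    (Complex.exp ((∑ j, (x j : ℂ) * x j) / 2))).congr (Filter.Eventually.of_forall fun t => ?_)
  simp only [sliceFun, segalBargmannKernel, smul_eq_mul]
  rw [← mul_assoc, ← Complex.exp_add]
  congr 1
  push_cast
  congr 1
  simp only [mul_comm, sq]
  ring

/-- For fixed x the multiplier is bounded: (x_j - t_j/2)² ≥ 0 gives x·t - |t|²/4 ≤ |x|². -/
theorem memLp_sliceFun {u : (Fin m → ℝ) → ℂ} (hu : MemLp u 2) (x : Fin m → ℝ) :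
    MemLp (sliceFun u x) 2 := by
  refine MemLp.of_le_mul (c := Real.exp (∑ j, x j ^ 2)) hu
    (integrable_sliceFun hu x).aestronglyMeasurable (Filter.Eventually.of_forall fun t => ?_)
  rw [sliceFun, norm_mul, Complex.norm_real, Real.norm_eq_abs, Real.abs_exp]
  refine mul_le_mul_of_nonneg_right (Real.exp_le_exp.2 ?_) (norm_nonneg _)
  rw [Finset.sum_div, ← Finset.sum_sub_distrib]
  refine Finset.sum_le_sum fun j _ => ?_
  nlinarith [sq_nonneg (x j - t j / 2)]

/-- The growth exp(|y|²) of |exp(-z·z/2)|² cancels the weight in the y direction exactly. What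
remains does not weight y, so Plancherel applies on each slice. -/
theorem enorm_kernelIntegral_sq (u : (Fin m → ℝ) → ℂ) (x y : Fin m → ℝ) :
    ENNReal.ofReal (Real.exp (-∑ j, ‖(x j : ℂ) + (y j : ℂ) * Complex.I‖ ^ 2)) *
        ‖kernelIntegral u (fun j => (x j : ℂ) + (y j : ℂ) * Complex.I)‖ₑ ^ 2
      = ENNReal.ofReal (Real.exp (-2 * ∑ j, x j ^ 2)) *
        ‖∫ t, Complex.exp (Complex.I * ∑ j, (t j : ℂ) * (y j : ℂ)) * sliceFun u x t‖ₑ ^ 2 := by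
  set z : Fin m → ℂ := fun j => (x j : ℂ) + (y j : ℂ) * Complex.I
  have h1 : kernelIntegral u z = Complex.exp (-(∑ j, z j * z j) / 2) *
      ∫ t, Complex.exp (Complex.I * ∑ j, (t j : ℂ) * (y j : ℂ)) * sliceFun u x t := by
    rw [kernelIntegral, ← integral_const_mul]
    refine integral_congr_ae (Filter.Eventually.of_forall fun t => ?_)
    simp only [sliceFun, segalBargmannKernel, smul_eq_mul]
    rw [← mul_assoc, ← mul_assoc, Complex.ofReal_exp, ← Complex.exp_add, ← Complex.exp_add]
    congr 2
    have : ∑ j, (t j : ℂ) * z j = ∑ j, (x j : ℂ) * t j + Complex.I * ∑ j, (t j : ℂ) * y j := by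
      rw [Finset.mul_sum, ← Finset.sum_add_distrib]
      refine Finset.sum_congr rfl fun j _ => ?_
      simp only [z]
      ring
    rw [this]
    push_cast
    simp only [sq]
    ring
  have h2 : ‖Complex.exp (-(∑ j, z j * z j) / 2)‖ ^ 2
      = Real.exp (-∑ j, (x j ^ 2 - y j ^ 2)) := by
    rw [Complex.norm_exp, ← Real.exp_nat_mul]
    congr 1
    have : (∑ j, z j * z j).re = ∑ j, (x j ^ 2 - y j ^ 2) := by
      rw [Complex.re_sum]
      refine Finset.sum_congr rfl fun j _ => ?_
      simp [z, sq]
    have h3 : (-(∑ j, z j * z j) / 2).re = -(∑ j, z j * z j).re / 2 := by simp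
    rw [h3, this]
    push_cast
    ring
  have h3 : ∑ j, ‖z j‖ ^ 2 = ∑ j, (x j ^ 2 + y j ^ 2) := by
    refine Finset.sum_congr rfl fun j _ => ?_
    rw [← Complex.normSq_eq_norm_sq, Complex.normSq_apply]
    simp [z, sq]
  rw [h1, enorm_mul, mul_pow, ← mul_assoc]
  congr 1
  rw [← ofReal_norm, ← ENNReal.ofReal_pow (norm_nonneg _), h2,
    ← ENNReal.ofReal_mul (Real.exp_pos _).le, ← Real.exp_add, h3]
  congr 2
  simp only [Finset.sum_add_distrib, Finset.sum_sub_distrib]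
  ring

/-- Plancherel on the slice of real part x, then Tonelli. The x-dependence collects into -2|x|² +
2x·t - |t|²/2 = -2|x - t/2|², whose Gaussian integral is independent of t. Working in `ENNReal`
makes finiteness a conclusion. -/
theorem lintegral_kernelIntegral_sq {u : (Fin m → ℝ) → ℂ} (hu : MemLp u 2) :
    ∫⁻ z : Fin m → ℂ, ENNReal.ofReal (Real.exp (-∑ j, ‖z j‖ ^ 2)) * ‖kernelIntegral u z‖ₑ ^ 2
      = ENNReal.ofReal ((2 * Real.pi) ^ m * Real.sqrt (Real.pi / 2) ^ m) *
        ∫⁻ x, ‖u x‖ₑ ^ 2 := by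
  have hc := (differentiable_kernelIntegral hu).continuous
  rw [lintegral_complex_pi _ (by fun_prop)]
  simp only [enorm_kernelIntegral_sq]
  have hmeas : AEMeasurable (Function.uncurry fun (x t : Fin m → ℝ) =>
      ENNReal.ofReal (Real.exp (-2 * ∑ j, x j ^ 2)) * ‖sliceFun u x t‖ₑ ^ 2)
      (volume.prod volume) := by
    have h1 : AEStronglyMeasurable (fun p : (Fin m → ℝ) × (Fin m → ℝ) => sliceFun u p.1 p.2)
        (volume.prod volume) := by
      refine AEStronglyMeasurable.mul (Continuous.aestronglyMeasurable (by fun_prop)) ?_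
      exact hu.aestronglyMeasurable.comp_snd
    have h2 : Continuous fun p : (Fin m → ℝ) × (Fin m → ℝ) =>
        ENNReal.ofReal (Real.exp (-2 * ∑ j, p.1 j ^ 2)) :=
      ENNReal.continuous_ofReal.comp (by fun_prop)
    exact h2.measurable.aemeasurable.mul (h1.enorm.pow_const 2)
  calc _ = ∫⁻ x : Fin m → ℝ, ENNReal.ofReal ((2 * Real.pi) ^ m) *
        ∫⁻ t, ENNReal.ofReal (Real.exp (-2 * ∑ j, x j ^ 2)) * ‖sliceFun u x t‖ₑ ^ 2 := by
        refine lintegral_congr fun x => ?_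
        rw [lintegral_const_mul' _ _ ENNReal.ofReal_ne_top,
          lintegral_const_mul' _ _ ENNReal.ofReal_ne_top,
          lintegral_integral_exp_I_sq (integrable_sliceFun hu x) (memLp_sliceFun hu x)]
        ring
    _ = ENNReal.ofReal ((2 * Real.pi) ^ m) * ∫⁻ t : Fin m → ℝ, ∫⁻ x : Fin m → ℝ,
        ENNReal.ofReal (Real.exp (-2 * ∑ j, x j ^ 2)) * ‖sliceFun u x t‖ₑ ^ 2 := by
        rw [lintegral_const_mul' _ _ ENNReal.ofReal_ne_top, lintegral_lintegral_swap hmeas]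
    _ = ENNReal.ofReal ((2 * Real.pi) ^ m) * ∫⁻ t : Fin m → ℝ,
        ENNReal.ofReal (Real.sqrt (Real.pi / 2) ^ m) * ‖u t‖ₑ ^ 2 := by
        congr 1
        refine lintegral_congr fun t => ?_
        have : ∀ x, ENNReal.ofReal (Real.exp (-2 * ∑ j, x j ^ 2)) * ‖sliceFun u x t‖ₑ ^ 2 =
            ENNReal.ofReal (Real.exp (-2 * ∑ j, (x j - t j / 2) ^ 2)) * ‖u t‖ₑ ^ 2 := by
          intro x
          rw [sliceFun, enorm_mul, mul_pow, ← mul_assoc]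
          congr 1
          rw [← ofReal_norm, Complex.norm_real, Real.norm_eq_abs, Real.abs_exp,
            ← ENNReal.ofReal_pow (Real.exp_pos _).le, ← ENNReal.ofReal_mul (Real.exp_pos _).le,
            ← Real.exp_nat_mul, ← Real.exp_add]
          congr 2
          simp only [sub_sq, Finset.sum_add_distrib, Finset.sum_sub_distrib, div_pow,
            ← Finset.sum_div]
          have h5 : ∑ j, 2 * x j * (t j / 2) = ∑ j, x j * t j :=
            Finset.sum_congr rfl fun j _ => by ring
          rw [h5]
          push_cast
          ring
        simp only [this]
        rw [lintegral_mul_const' _ _ (by simp), lintegral_exp_neg_two_mul_sq]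
    _ = _ := by
        rw [lintegral_const_mul' _ _ ENNReal.ofReal_ne_top, ← mul_assoc,
          ← ENNReal.ofReal_mul (by positivity)]

end Isometry

/-! ### Normalization, polarization and Clifford-valued inner products -/

section InnerProduct

variable {m : ℕ}

/-- The constant by which the Segal-Bargmann integral scales squared norms. -/
def isometryConst (m : ℕ) : ℝ := (2 * Real.pi) ^ m * Real.sqrt (Real.pi / 2) ^ m

theorem isometryConst_pos (m : ℕ) : 0 < isometryConst m := by
  unfold isometryConst
  positivity

/-- The normalizations of the two inner products match because √(2π) · √(π/2) = π. -/
theorem prefactor_sq_mul_isometryConst (m : ℕ) :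
    (Real.pi ^ m)⁻¹ * (((2 * Real.pi) ^ ((m : ℝ) / 2))⁻¹ ^ 2 * isometryConst m)
      = ((2 * Real.pi) ^ ((m : ℝ) / 2))⁻¹ := by
  have h1 : (2 * Real.pi) ^ ((m : ℝ) / 2) = Real.sqrt (2 * Real.pi) ^ m := by
    rw [Real.sqrt_eq_rpow, ← Real.rpow_natCast, ← Real.rpow_mul (by positivity)]
    congr 1
    ring
  rw [h1, isometryConst]
  have h2 : Real.sqrt (2 * Real.pi) ^ 2 = 2 * Real.pi := Real.sq_sqrt (by positivity)
  have h3 : Real.sqrt (2 * Real.pi) * Real.sqrt (Real.pi / 2) = Real.pi := by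
    rw [← Real.sqrt_mul (by positivity), show 2 * Real.pi * (Real.pi / 2) = Real.pi ^ 2 by ring,
      Real.sqrt_sq Real.pi_pos.le]
  have hA : (2 * Real.pi) ^ m = Real.sqrt (2 * Real.pi) ^ m * Real.sqrt (2 * Real.pi) ^ m := by
    rw [← mul_pow, ← sq, h2]
  have hB : Real.pi ^ m = Real.sqrt (2 * Real.pi) ^ m * Real.sqrt (Real.pi / 2) ^ m := by
    rw [← mul_pow, h3]
  have hs : Real.sqrt (2 * Real.pi) ^ m ≠ 0 := by positivity
  have hs' : Real.sqrt (Real.pi / 2) ^ m ≠ 0 := by positivity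
  rw [hA, hB]
  field_simp

section Scalar

variable {u v : (Fin m → ℝ) → ℂ}

theorem integral_kernelIntegral_sq (hu : MemLp u 2) :
    Integrable (fun z : Fin m → ℂ => Real.exp (-∑ j, ‖z j‖ ^ 2) * ‖kernelIntegral u z‖ ^ 2) ∧
    ∫ z : Fin m → ℂ, Real.exp (-∑ j, ‖z j‖ ^ 2) * ‖kernelIntegral u z‖ ^ 2
      = isometryConst m * ∫ x, ‖u x‖ ^ 2 := by
  have hc := (differentiable_kernelIntegral hu).continuous
  have hcont : Continuous fun z : Fin m → ℂ =>
      Real.exp (-∑ j, ‖z j‖ ^ 2) * ‖kernelIntegral u z‖ ^ 2 := by fun_prop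
  have hnn : ∀ z : Fin m → ℂ, 0 ≤ Real.exp (-∑ j, ‖z j‖ ^ 2) * ‖kernelIntegral u z‖ ^ 2 :=
    fun z => by positivity
  have hui : Integrable fun x => ‖u x‖ ^ 2 :=
    (memLp_two_iff_integrable_sq_norm hu.aestronglyMeasurable).1 hu
  have hlin : ∫⁻ z : Fin m → ℂ, ENNReal.ofReal
      (Real.exp (-∑ j, ‖z j‖ ^ 2) * ‖kernelIntegral u z‖ ^ 2)
      = ENNReal.ofReal (isometryConst m * ∫ x, ‖u x‖ ^ 2) := by
    rw [ENNReal.ofReal_mul (isometryConst_pos m).le, ofReal_integral_eq_lintegral_ofReal hui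
      (Filter.Eventually.of_forall fun x => by positivity)]
    simp only [ENNReal.ofReal_mul (Real.exp_pos _).le, ENNReal.ofReal_pow (norm_nonneg _),
      ofReal_norm]
    exact lintegral_kernelIntegral_sq hu
  refine ⟨⟨hcont.aestronglyMeasurable, ?_⟩, ?_⟩
  · rw [hasFiniteIntegral_iff_ofReal (Filter.Eventually.of_forall hnn), hlin]
    exact ENNReal.ofReal_lt_top
  · rw [integral_eq_lintegral_of_nonneg_ae (Filter.Eventually.of_forall hnn)
      hcont.aestronglyMeasurable, hlin, ENNReal.toReal_ofReal]
    exact mul_nonneg (isometryConst_pos m).le (integral_nonneg fun x => by positivity)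

theorem kernelIntegral_add_const_mul (hu : MemLp u 2) (hv : MemLp v 2) (c : ℂ) (z : Fin m → ℂ) :
    kernelIntegral (fun x => u x + c * v x) z = kernelIntegral u z + c * kernelIntegral v z := by
  rw [kernelIntegral, kernelIntegral, kernelIntegral, ← integral_const_mul, ← integral_add
    (integrable_segalBargmannKernel_smul hu z)
    ((integrable_segalBargmannKernel_smul hv z).const_mul c)]
  refine integral_congr_ae (Filter.Eventually.of_forall fun x => ?_)
  simp only [smul_eq_mul]
  ring

theorem integral_add_four {α : Type*} [MeasurableSpace α] {μ : Measure α} {f₁ f₂ f₃ f₄ : α → ℂ}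
    (h₁ : Integrable f₁ μ) (h₂ : Integrable f₂ μ) (h₃ : Integrable f₃ μ) (h₄ : Integrable f₄ μ) :
    Integrable (fun x => f₁ x + f₂ x + f₃ x + f₄ x) μ ∧
    ∫ x, f₁ x + f₂ x + f₃ x + f₄ x ∂μ
      = ∫ x, f₁ x ∂μ + ∫ x, f₂ x ∂μ + ∫ x, f₃ x ∂μ + ∫ x, f₄ x ∂μ := by
  have h₁₂ : Integrable (fun x => f₁ x + f₂ x) μ := h₁.add h₂
  have h₁₂₃ : Integrable (fun x => f₁ x + f₂ x + f₃ x) μ := h₁₂.add h₃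
  exact ⟨h₁₂₃.add h₄, by rw [integral_add h₁₂₃ h₄, integral_add h₁₂ h₃, integral_add h₁ h₂]⟩

theorem conj_mul_eq_polarization (a b : ℂ) :
    (starRingEnd ℂ) a * b = ((‖a + 1 * b‖ ^ 2 : ℝ) : ℂ) * (1 / 4)
      + ((‖a + (-1) * b‖ ^ 2 : ℝ) : ℂ) * (-1 / 4)
      + ((‖a + Complex.I * b‖ ^ 2 : ℝ) : ℂ) * (-Complex.I / 4)
      + ((‖a + (-Complex.I) * b‖ ^ 2 : ℝ) : ℂ) * (Complex.I / 4) := by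
  simp only [← Complex.normSq_eq_norm_sq, Complex.normSq_eq_conj_mul_self, map_add, map_mul,
    map_neg, map_one, Complex.conj_I]
  linear_combination (1 / 2 * ((starRingEnd ℂ) a * b - (starRingEnd ℂ) b * a)) * Complex.I_sq

/-- Polarization: the norm identity is applied to u + cv for c = ±1, ±i. Integrability of the mixed
products comes from the same decomposition. -/
theorem integral_conj_kernelIntegral_mul (hu : MemLp u 2) (hv : MemLp v 2) :
    Integrable (fun x => (starRingEnd ℂ) (u x) * v x) ∧
    Integrable (fun z : Fin m → ℂ => (Real.exp (-∑ j, ‖z j‖ ^ 2) : ℂ) *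
      ((starRingEnd ℂ) (kernelIntegral u z) * kernelIntegral v z)) ∧
    ∫ z : Fin m → ℂ, (Real.exp (-∑ j, ‖z j‖ ^ 2) : ℂ) *
      ((starRingEnd ℂ) (kernelIntegral u z) * kernelIntegral v z)
      = isometryConst m * ∫ x, (starRingEnd ℂ) (u x) * v x := by
  have hw : ∀ c : ℂ, MemLp (fun x => u x + c * v x) 2 := fun c => hu.add (hv.const_mul c)
  have hR : ∀ c d : ℂ, Integrable fun x => ((‖u x + c * v x‖ ^ 2 : ℝ) : ℂ) * d := fun c d =>
    (((memLp_two_iff_integrable_sq_norm (hw c).aestronglyMeasurable).1 (hw c)).ofReal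
      (𝕜 := ℂ)).mul_const d
  have hC : ∀ c d : ℂ, Integrable fun z : Fin m → ℂ => ((Real.exp (-∑ j, ‖z j‖ ^ 2) *
      ‖kernelIntegral u z + c * kernelIntegral v z‖ ^ 2 : ℝ) : ℂ) * d := fun c d => by
    have h := (integral_kernelIntegral_sq (hw c)).1
    simp only [kernelIntegral_add_const_mul hu hv] at h
    exact (h.ofReal (𝕜 := ℂ)).mul_const d
  have hCR : ∀ c d : ℂ, ∫ z : Fin m → ℂ, ((Real.exp (-∑ j, ‖z j‖ ^ 2) *
      ‖kernelIntegral u z + c * kernelIntegral v z‖ ^ 2 : ℝ) : ℂ) * d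
      = isometryConst m * ∫ x, ((‖u x + c * v x‖ ^ 2 : ℝ) : ℂ) * d := fun c d => by
    have h := (integral_kernelIntegral_sq (hw c)).2
    simp only [kernelIntegral_add_const_mul hu hv] at h
    rw [integral_mul_const, integral_mul_const, integral_complex_ofReal, h,
      integral_complex_ofReal]
    push_cast
    ring
  have e1 : ∀ z : Fin m → ℂ, (Real.exp (-∑ j, ‖z j‖ ^ 2) : ℂ) *
      ((starRingEnd ℂ) (kernelIntegral u z) * kernelIntegral v z) = _ := fun z => by
    rw [conj_mul_eq_polarization, mul_add, mul_add, mul_add, ← mul_assoc, ← mul_assoc,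
      ← mul_assoc, ← mul_assoc, ← Complex.ofReal_mul, ← Complex.ofReal_mul, ← Complex.ofReal_mul,
      ← Complex.ofReal_mul]
  simp only [e1]
  simp only [conj_mul_eq_polarization (u _) (v _)]
  have i := integral_add_four (hR 1 (1 / 4)) (hR (-1) (-1 / 4)) (hR Complex.I (-Complex.I / 4))
    (hR (-Complex.I) (Complex.I / 4))
  have k := integral_add_four (hC 1 (1 / 4)) (hC (-1) (-1 / 4)) (hC Complex.I (-Complex.I / 4))
    (hC (-Complex.I) (Complex.I / 4))
  refine ⟨i.1, k.1, ?_⟩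
  rw [k.2, i.2, hCR, hCR, hCR, hCR]
  ring

end Scalar

section Clifford

variable {f g : (Fin m → ℝ) → ComplexClifford m}

theorem memLp_coeff (hf : MemLp f 2) (A : Finset (Fin m)) :
    MemLp (fun x => coeffCLM A (f x)) 2 :=
  (coeffCLM A).comp_memLp' hf

theorem coeff_kernelIntegral (hf : MemLp f 2) (A : Finset (Fin m)) (z : Fin m → ℂ) :
    coeffCLM A (kernelIntegral f z) = kernelIntegral (fun x => coeffCLM A (f x)) z := by
  rw [kernelIntegral, kernelIntegral, ← ContinuousLinearMap.integral_comp_comm _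
    (integrable_segalBargmannKernel_smul hf z)]
  simp

theorem segalBargmann_eq (f : (Fin m → ℝ) → ComplexClifford m) (z : Fin m → ℂ) :
    segalBargmann f z = ((2 * Real.pi) ^ ((m : ℝ) / 2))⁻¹ • kernelIntegral f z := rfl

theorem differentiable_segalBargmann (hf : MemLp f 2) : Differentiable ℂ (segalBargmann f) :=
  (differentiable_kernelIntegral hf).const_smul (((2 * Real.pi) ^ ((m : ℝ) / 2))⁻¹ : ℝ)

theorem integral_segalBargmann_sq (hf : MemLp f 2) :
    Integrable (fun z : Fin m → ℂ => Real.exp (-∑ j, ‖z j‖ ^ 2) * ‖segalBargmann f z‖ ^ 2) ∧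
    (Real.pi ^ m)⁻¹ * ∫ z : Fin m → ℂ, Real.exp (-∑ j, ‖z j‖ ^ 2) * ‖segalBargmann f z‖ ^ 2
      = ((2 * Real.pi) ^ ((m : ℝ) / 2))⁻¹ * ∫ x, ‖f x‖ ^ 2 := by
  have h1 : ∀ z : Fin m → ℂ, Real.exp (-∑ j, ‖z j‖ ^ 2) * ‖segalBargmann f z‖ ^ 2
      = ((2 * Real.pi) ^ ((m : ℝ) / 2))⁻¹ ^ 2 * ∑ A, Real.exp (-∑ j, ‖z j‖ ^ 2) *
        ‖kernelIntegral (fun x => coeffCLM A (f x)) z‖ ^ 2 := by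
    intro z
    rw [segalBargmann_eq, norm_smul, mul_pow, norm_sq_eq_sum_coeff, Real.norm_eq_abs, sq_abs,
      ← Finset.mul_sum]
    simp only [coeff_kernelIntegral hf]
    ring
  have hA := fun A => integral_kernelIntegral_sq (memLp_coeff hf A)
  simp only [h1]
  refine ⟨(integrable_finsetSum _ fun A _ => (hA A).1).const_mul _, ?_⟩
  rw [integral_const_mul, integral_finsetSum _ fun A _ => (hA A).1]
  simp only [(hA _).2, norm_sq_eq_sum_coeff (f _)]
  rw [integral_finsetSum _ fun A _ =>
    (memLp_two_iff_integrable_sq_norm (memLp_coeff hf A).aestronglyMeasurable).1 (memLp_coeff hf A),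
    ← Finset.mul_sum]
  nth_rewrite 2 [← prefactor_sq_mul_isometryConst]
  ring

theorem integral_dagger_segalBargmann_mul (hf : MemLp f 2) (hg : MemLp g 2) :
    Integrable (fun x => cliffordDagger (f x) * g x) ∧
    Integrable (fun z : Fin m → ℂ => Real.exp (-∑ j, ‖z j‖ ^ 2) •
      (cliffordDagger (segalBargmann f z) * segalBargmann g z)) ∧
    innerBargmann (segalBargmann f) (segalBargmann g) = innerL2 f g := by
  have h := fun A B => integral_conj_kernelIntegral_mul (memLp_coeff hf A) (memLp_coeff hg B)
  set c : ℝ := ((2 * Real.pi) ^ ((m : ℝ) / 2))⁻¹ with hc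
  have e1 : ∀ z : Fin m → ℂ, Real.exp (-∑ j, ‖z j‖ ^ 2) •
      (cliffordDagger (segalBargmann f z) * segalBargmann g z) = (c ^ 2) • ∑ A, ∑ B,
        ((Real.exp (-∑ j, ‖z j‖ ^ 2) : ℂ) *
          ((starRingEnd ℂ) (kernelIntegral (fun x => coeffCLM A (f x)) z) *
            kernelIntegral (fun x => coeffCLM B (g x)) z)) •
          (cliffordBar (cliffordUnit A) * cliffordUnit B) := by
    intro z
    rw [dagger_mul_eq_sum, Finset.smul_sum, Finset.smul_sum]
    refine Finset.sum_congr rfl fun A _ => ?_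
    rw [Finset.smul_sum, Finset.smul_sum]
    refine Finset.sum_congr rfl fun B _ => ?_
    have hfz : coeffCLM A (segalBargmann f z)
        = (c : ℂ) * kernelIntegral (fun x => coeffCLM A (f x)) z := by
      rw [segalBargmann_eq, ← coeff_kernelIntegral hf, ← Complex.coe_smul, map_smul, smul_eq_mul]
    have hgz : coeffCLM B (segalBargmann g z)
        = (c : ℂ) * kernelIntegral (fun x => coeffCLM B (g x)) z := by
      rw [segalBargmann_eq, ← coeff_kernelIntegral hg, ← Complex.coe_smul, map_smul, smul_eq_mul]
    rw [hfz, hgz, ← Complex.coe_smul, ← Complex.coe_smul, smul_smul, smul_smul, map_mul,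
      Complex.conj_ofReal]
    congr 1
    push_cast
    ring
  have i1 : ∀ A B, Integrable fun x => ((starRingEnd ℂ) (coeffCLM A (f x)) * coeffCLM B (g x)) •
      ((cliffordBar (cliffordUnit A) * cliffordUnit B : ComplexClifford m)) :=
    fun A B => (h A B).1.smul_const _
  have i2 : ∀ A B, Integrable fun z : Fin m → ℂ => ((Real.exp (-∑ j, ‖z j‖ ^ 2) : ℂ) *
          ((starRingEnd ℂ) (kernelIntegral (fun x => coeffCLM A (f x)) z) *
            kernelIntegral (fun x => coeffCLM B (g x)) z)) •
          (cliffordBar (cliffordUnit A) * cliffordUnit B : ComplexClifford m) :=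
    fun A B => (h A B).2.1.smul_const _
  refine ⟨?_, ?_, ?_⟩
  · simp only [dagger_mul_eq_sum]
    exact integrable_finsetSum _ fun A _ => integrable_finsetSum _ fun B _ => i1 A B
  · simp only [e1]
    exact (integrable_finsetSum _ fun A _ =>
      integrable_finsetSum _ fun B _ => i2 A B).smul (c ^ 2)
  · rw [innerBargmann, innerL2]
    simp only [e1, dagger_mul_eq_sum (f _)]
    rw [integral_smul, integral_finsetSum _ fun A _ => integrable_finsetSum _ fun B _ => i2 A B,
      integral_finsetSum _ fun A _ => integrable_finsetSum _ fun B _ => i1 A B]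
    simp only [integral_finsetSum _ fun B _ => i1 _ B, integral_finsetSum _ fun B _ => i2 _ B]
    simp only [integral_smul_const, (h _ _).2.2]
    simp only [mul_smul, ← Finset.smul_sum]
    rw [Complex.coe_smul, smul_smul, smul_smul, mul_assoc, hc, prefactor_sq_mul_isometryConst]

end Clifford

end InnerProduct

/-! ### The Dirac operators -/

section Dirac

variable {m : ℕ}

theorem diracOp_eq (g : (Fin m → ℝ) → ComplexClifford m) (x : Fin m → ℝ) :
    diracOp g x = ∑ j, leftMul (cliffordGen j) (fderiv ℝ g x (Pi.single j 1)) := rfl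

theorem contDiff_diracOp {g : (Fin m → ℝ) → ComplexClifford m} (hg : ContDiff ℝ (⊤ : ℕ∞) g) :
    ContDiff ℝ (⊤ : ℕ∞) (diracOp g) := by
  have h1 : ContDiff ℝ (⊤ : ℕ∞) (fderiv ℝ g) := (contDiff_infty_iff_fderiv.1 hg).2
  refine ContDiff.sum fun j _ => ?_
  exact ((leftMul (cliffordGen j)).restrictScalars ℝ).contDiff.comp (h1.clm_apply contDiff_const)

theorem contDiff_diracOp_iterate {g : (Fin m → ℝ) → ComplexClifford m}
    (hg : ContDiff ℝ (⊤ : ℕ∞) g) (n : ℕ) : ContDiff ℝ (⊤ : ℕ∞) (diracOp^[n] g) := by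
  induction n generalizing g with
  | zero => exact hg
  | succ n ih => exact ih (contDiff_diracOp hg)

theorem differentiable_complexDiracOp {h : (Fin m → ℂ) → ComplexClifford m}
    (hh : Differentiable ℂ h) : Differentiable ℂ (complexDiracOp h) :=
  Differentiable.fun_sum fun j _ =>
    (leftMul (cliffordGen j)).differentiable.comp (differentiable_fderiv_apply hh _)

theorem differentiable_complexDiracOp_iterate {h : (Fin m → ℂ) → ComplexClifford m}
    (hh : Differentiable ℂ h) (n : ℕ) : Differentiable ℂ (complexDiracOp^[n] h) := by
  induction n generalizing h with
  | zero => exact hh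
  | succ n ih => exact ih (differentiable_complexDiracOp hh)

/-- The inclusion `ℝ^m → ℂ^m`. -/
def ofRealPi (m : ℕ) : (Fin m → ℝ) →L[ℝ] (Fin m → ℂ) :=
  ContinuousLinearMap.pi fun j => Complex.ofRealCLM.comp (ContinuousLinearMap.proj j)

@[simp]
theorem ofRealPi_apply (x : Fin m → ℝ) (j : Fin m) : ofRealPi m x j = (x j : ℂ) := rfl

theorem ofRealPi_single (j : Fin m) : ofRealPi m (Pi.single j 1) = Pi.single j 1 := by
  funext k
  by_cases hk : k = j
  · subst hk; simp
  · simp [hk]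

theorem hasFDerivAt_comp_ofRealPi {E : Type*} [NormedAddCommGroup E] [NormedSpace ℂ E]
    {h : (Fin m → ℂ) → E} (hh : Differentiable ℂ h) (x : Fin m → ℝ) :
    HasFDerivAt (fun x => h (ofRealPi m x))
      (((fderiv ℂ h (ofRealPi m x)).restrictScalars ℝ).comp (ofRealPi m)) x :=
  ((hh _).hasFDerivAt.restrictScalars ℝ).comp x (ofRealPi m).hasFDerivAt

theorem fderiv_comp_ofRealPi {E : Type*} [NormedAddCommGroup E] [NormedSpace ℂ E]
    {h : (Fin m → ℂ) → E} (hh : Differentiable ℂ h) (x : Fin m → ℝ) (j : Fin m) :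
    fderiv ℝ (fun x => h (ofRealPi m x)) x (Pi.single j 1)
      = fderiv ℂ h (ofRealPi m x) (Pi.single j 1) := by
  rw [(hasFDerivAt_comp_ofRealPi hh x).fderiv, ContinuousLinearMap.comp_apply, ofRealPi_single]
  rfl

theorem contDiff_comp_ofRealPi {E : Type*} [NormedAddCommGroup E] [NormedSpace ℂ E]
    [FiniteDimensional ℂ E] {h : (Fin m → ℂ) → E} (hh : Differentiable ℂ h) :
    ContDiff ℝ (⊤ : ℕ∞) fun x => h (ofRealPi m x) :=
  ((contDiff_of_differentiable hh).restrict_scalars ℝ).comp (ofRealPi m).contDiff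

theorem diracOp_comp_ofRealPi {h : (Fin m → ℂ) → ComplexClifford m} (hh : Differentiable ℂ h) :
    diracOp (fun x => h (ofRealPi m x)) = fun x => complexDiracOp h (ofRealPi m x) := by
  funext x
  simp only [diracOp, complexDiracOp, fderiv_comp_ofRealPi hh]

/-- The complex derivative along a standard basis vector restricts to the real partial derivative.
Monogenicity of an entire function can therefore be tested on ℝ^m. -/
theorem diracOp_iterate_comp_ofRealPi {h : (Fin m → ℂ) → ComplexClifford m}
    (hh : Differentiable ℂ h) (n : ℕ) :
    diracOp^[n] (fun x => h (ofRealPi m x)) = fun x => complexDiracOp^[n] h (ofRealPi m x) := by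
  induction n generalizing h with
  | zero => rfl
  | succ n ih =>
    rw [Function.iterate_succ_apply, diracOp_comp_ofRealPi hh,
      ih (differentiable_complexDiracOp hh), Function.iterate_succ_apply]

theorem diracOp_comp_add_right (g : (Fin m → ℝ) → ComplexClifford m) (y : Fin m → ℝ) :
    diracOp (fun x => g (x + y)) = fun x => diracOp g (x + y) := by
  funext x
  simp only [diracOp, fderiv_comp_add_right]

theorem diracOp_mul_add_mul {f g : (Fin m → ℝ) → ComplexClifford m}
    (hf : ContDiff ℝ (⊤ : ℕ∞) f) (hg : ContDiff ℝ (⊤ : ℕ∞) g) (a b : ComplexClifford m) (n : ℕ) :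
    diracOp^[n] (fun x => f x * a + g x * b)
      = fun x => diracOp^[n] f x * a + diracOp^[n] g x * b := by
  induction n generalizing f g with
  | zero => rfl
  | succ n ih =>
    have h1 : diracOp (fun x => f x * a + g x * b) = fun x => diracOp f x * a + diracOp g x * b := by
      funext x
      have hfx := (hf.differentiable (by simp) x).hasFDerivAt
      have hgx := (hg.differentiable (by simp) x).hasFDerivAt
      have h2 := (((rightMul a).restrictScalars ℝ).hasFDerivAt.comp x hfx).add
        (((rightMul b).restrictScalars ℝ).hasFDerivAt.comp x hgx)
      have h3 : fderiv ℝ (fun x => f x * a + g x * b) x = _ := h2.fderiv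
      simp only [diracOp, h3, Finset.sum_mul, ← Finset.sum_add_distrib]
      refine Finset.sum_congr rfl fun j _ => ?_
      simp [mul_add, mul_assoc]
    rw [Function.iterate_succ_apply, h1, ih (contDiff_diracOp hf) (contDiff_diracOp hg)]
    rfl

end Dirac

/-! ### The transform of an `s`-monogenic function is `s`-monogenic -/

section Weak

variable {m : ℕ}

/-- Integration by parts. The test function is scalar, so the generators pass through the integral.
-/
theorem integral_smul_diracOp {φ : (Fin m → ℝ) → ℝ} (hφ : ContDiff ℝ (⊤ : ℕ∞) φ)
    (hφc : HasCompactSupport φ) {u : (Fin m → ℝ) → ComplexClifford m}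
    (hu : ContDiff ℝ (⊤ : ℕ∞) u) :
    ∫ x, φ x • diracOp u x
      = -∑ j, cliffordGen j * ∫ x, fderiv ℝ φ x (Pi.single j 1) • u x := by
  have hφ' : Continuous (fderiv ℝ φ) := hφ.continuous_fderiv (by simp)
  have hu' : Continuous (fderiv ℝ u) := hu.continuous_fderiv (by simp)
  have hi1 : ∀ j, Integrable fun x => φ x • fderiv ℝ u x (Pi.single j 1) := fun j =>
    (hφ.continuous.smul (hu'.clm_apply continuous_const)).integrable_of_hasCompactSupport
      hφc.smul_right
  have hi2 : ∀ j : Fin m, Integrable fun x => fderiv ℝ φ x (Pi.single j 1) • u x := fun j =>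
    ((hφ'.clm_apply continuous_const).smul hu.continuous).integrable_of_hasCompactSupport
      (hφc.fderiv_apply ℝ _).smul_right
  have hi3 : Integrable fun x => φ x • u x :=
    (hφ.continuous.smul hu.continuous).integrable_of_hasCompactSupport hφc.smul_right
  have e1 : ∀ x, φ x • diracOp u x
      = ∑ j, leftMul (cliffordGen j) (φ x • fderiv ℝ u x (Pi.single j 1)) := by
    intro x
    rw [diracOp_eq, Finset.smul_sum]
    refine Finset.sum_congr rfl fun j _ => ?_
    simp
  simp only [e1]
  rw [integral_finsetSum _ fun j _ => (leftMul (cliffordGen j)).integrable_comp (hi1 j),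
    ← Finset.sum_neg_distrib]
  refine Finset.sum_congr rfl fun j _ => ?_
  rw [ContinuousLinearMap.integral_comp_comm _ (hi1 j),
    integral_smul_fderiv_eq_neg_fderiv_smul_of_integrable (hi2 j) (hi1 j) hi3
      (fun x _ => hφ.differentiable (by simp) x) (fun x _ => hu.differentiable (by simp) x)]
  simp

/-- Testing the derivatives of a Gaussian average against test functions. -/
theorem integral_smul_diracOp_iterate_average {g H : (Fin m → ℝ) → ComplexClifford m}
    {G : (Fin m → ℝ) → ℝ} (hg : ContDiff ℝ (⊤ : ℕ∞) g) (hH : ContDiff ℝ (⊤ : ℕ∞) H)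
    (h0 : ∀ φ : (Fin m → ℝ) → ℝ, ContDiff ℝ (⊤ : ℕ∞) φ → HasCompactSupport φ →
      Integrable (fun y => G y • ∫ x, φ x • g (x + y)) ∧
      ∫ x, φ x • H x = ∫ y, G y • ∫ x, φ x • g (x + y)) (n : ℕ) :
    ∀ φ : (Fin m → ℝ) → ℝ, ContDiff ℝ (⊤ : ℕ∞) φ → HasCompactSupport φ →
      Integrable (fun y => G y • ∫ x, φ x • diracOp^[n] g (x + y)) ∧
      ∫ x, φ x • diracOp^[n] H x = ∫ y, G y • ∫ x, φ x • diracOp^[n] g (x + y) := by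
  induction n generalizing g H with
  | zero => exact h0
  | succ n ih =>
    -- The induction runs over the pair (g, H): the hypothesis for their Dirac derivatives at φ
    -- reduces to the hypothesis for g and H at the ∂_jφ. No integrability of derivatives of g is
    -- ever needed.
    refine ih (contDiff_diracOp hg) (contDiff_diracOp hH) fun φ hφ hφc => ?_
    have hj : ∀ j : Fin m, ContDiff ℝ (⊤ : ℕ∞) (fun x => fderiv ℝ φ x (Pi.single j 1)) ∧
        HasCompactSupport fun x => fderiv ℝ φ x (Pi.single j 1) := fun j =>
      ⟨(contDiff_infty_iff_fderiv.1 hφ).2.clm_apply contDiff_const, hφc.fderiv_apply ℝ _⟩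
    have e1 : ∀ y, G y • ∫ x, φ x • diracOp g (x + y) = -∑ j, leftMul (cliffordGen j)
        (G y • ∫ x, fderiv ℝ φ x (Pi.single j 1) • g (x + y)) := by
      intro y
      have h1 := integral_smul_diracOp hφ hφc (u := fun x => g (x + y))
        (hg.comp (contDiff_id.add contDiff_const))
      rw [diracOp_comp_add_right] at h1
      rw [h1, smul_neg, Finset.smul_sum]
      simp
    simp only [e1]
    have hi := fun j => (h0 _ (hj j).1 (hj j).2).1
    refine ⟨(integrable_finsetSum _ fun j _ =>
      (leftMul (cliffordGen j)).integrable_comp (hi j)).neg, ?_⟩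
    rw [integral_smul_diracOp hφ hφc hH, integral_neg,
      integral_finsetSum _ fun j _ => (leftMul (cliffordGen j)).integrable_comp (hi j)]
    congr 1
    refine Finset.sum_congr rfl fun j _ => ?_
    rw [ContinuousLinearMap.integral_comp_comm _ (hi j), (h0 _ (hj j).1 (hj j).2).2,
      leftMul_apply]

/-- Completing the square: -|x|²/2 + x·y - |y|²/4 - |y|²/4 = -|y - x|²/2. The factor exp(-|y|²/4) of
the domain turns the kernel into a translation-invariant Gaussian. -/
theorem segalBargmannKernel_ofReal_smul {E : Type*} [NormedAddCommGroup E] [NormedSpace ℂ E]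
    (x y : Fin m → ℝ) (v : E) :
    segalBargmannKernel (ofRealPi m x) y • (Real.exp (-(∑ j, y j ^ 2) / 4) • v)
      = Real.exp (-(∑ j, (y j - x j) ^ 2) / 2) • v := by
  rw [← Complex.coe_smul, ← Complex.coe_smul, smul_smul]
  congr 1
  rw [segalBargmannKernel, Complex.ofReal_exp, Complex.ofReal_exp, ← Complex.exp_add]
  congr 1
  push_cast
  have h1 : ∑ j, ((y j : ℂ) - x j) ^ 2
      = ∑ j, (y j : ℂ) * y j - 2 * ∑ j, (y j : ℂ) * x j + ∑ j, (x j : ℂ) * x j := by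
    rw [Finset.mul_sum, ← Finset.sum_sub_distrib, ← Finset.sum_add_distrib]
    exact Finset.sum_congr rfl fun j _ => by ring
  simp only [ofRealPi_apply]
  rw [h1]
  simp only [sq]
  ring

theorem kernelIntegral_ofReal {E : Type*} [NormedAddCommGroup E] [NormedSpace ℂ E]
    (g : (Fin m → ℝ) → E) (x : Fin m → ℝ) :
    kernelIntegral (fun x => Real.exp (-(∑ j, x j ^ 2) / 4) • g x) (ofRealPi m x)
      = ∫ y, Real.exp (-(∑ j, y j ^ 2) / 2) • g (x + y) := by
  simp only [kernelIntegral, segalBargmannKernel_ofReal_smul]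
  rw [← integral_add_left_eq_self _ x]
  simp

theorem integrable_gaussian_smul_translate {E : Type*} [NormedAddCommGroup E] [NormedSpace ℂ E]
    {g : (Fin m → ℝ) → E} (hf : MemLp (fun x => Real.exp (-(∑ j, x j ^ 2) / 4) • g x) 2)
    (x : Fin m → ℝ) : Integrable fun y => Real.exp (-(∑ j, y j ^ 2) / 2) • g (x + y) := by
  have h1 := integrable_segalBargmannKernel_smul hf (ofRealPi m x)
  simp only [segalBargmannKernel_ofReal_smul] at h1
  simpa using h1.comp_add_left x

/-- On ℝ^m the function is the Gaussian average of translates of g, so its s-th Dirac derivative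
annihilates all test functions. It is continuous, hence zero on ℝ^m, and the identity theorem
carries this to ℂ^m. -/
theorem diracOp_iterate_kernelIntegral_eq_zero {g : (Fin m → ℝ) → ComplexClifford m} {s : ℕ}
    (hg : g ∈ realMonogenic m s)
    (hf : MemLp (fun x => Real.exp (-(∑ j, x j ^ 2) / 4) • g x) 2) :
    complexDiracOp^[s] (kernelIntegral fun x => Real.exp (-(∑ j, x j ^ 2) / 4) • g x) = 0 := by
  set f : (Fin m → ℝ) → ComplexClifford m := fun x => Real.exp (-(∑ j, x j ^ 2) / 4) • g x
  have hd := differentiable_kernelIntegral hf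
  have hH := contDiff_comp_ofRealPi hd
  refine eq_zero_of_real_eq_zero (differentiable_complexDiracOp_iterate hd s) fun x => ?_
  change complexDiracOp^[s] (kernelIntegral f) (ofRealPi m x) = 0
  rw [← congrFun (diracOp_iterate_comp_ofRealPi hd s) x]
  have hcont := (contDiff_diracOp_iterate hH s).continuous
  have hgc : Continuous g := hg.1.continuous
  have key := integral_smul_diracOp_iterate_average (G := fun y => Real.exp (-(∑ j, y j ^ 2) / 2))
    hg.1 hH ?_ s
  · have hae : diracOp^[s] (fun x => kernelIntegral f (ofRealPi m x)) =ᵐ[volume] 0 := by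
      refine ae_eq_zero_of_integral_contDiff_smul_eq_zero hcont.locallyIntegrable
        fun φ hφ hφc => ?_
      rw [(key φ hφ hφc).2, hg.2]
      simp
    exact congrFun (Continuous.ae_eq_iff_eq volume hcont continuous_zero |>.1 hae) x
  · intro φ hφ hφc
    -- The scalar function ‖g‖ satisfies the same L² condition, so its own kernel integral is
    -- continuous. That makes the y-integral of the norm continuous in x, which is what Fubini needs
    -- over the compact support of φ.
    have hnorm : MemLp (fun x => Real.exp (-(∑ j, x j ^ 2) / 4) • (‖g x‖ : ℂ)) 2 := by
      refine hf.norm.ofReal (K := ℂ) |>.congr_norm (by fun_prop) ?_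
      refine Filter.Eventually.of_forall fun x => ?_
      simp [f, norm_smul]
    have hN : Continuous fun x : Fin m → ℝ =>
        ∫ y : Fin m → ℝ, Real.exp (-(∑ j, y j ^ 2) / 2) • (‖g (x + y)‖ : ℂ) := by
      have := (differentiable_kernelIntegral hnorm).continuous.comp (ofRealPi m).continuous
      simpa only [Function.comp_def, kernelIntegral_ofReal _ _] using this
    have hN' : Continuous fun x : Fin m → ℝ =>
        ∫ y : Fin m → ℝ, Real.exp (-(∑ j, y j ^ 2) / 2) * ‖g (x + y)‖ := by
      refine (Complex.continuous_re.comp hN).congr fun x => ?_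
      have : ∀ y : Fin m → ℝ, Real.exp (-(∑ j, y j ^ 2) / 2) • (‖g (x + y)‖ : ℂ)
          = ((Real.exp (-(∑ j, y j ^ 2) / 2) * ‖g (x + y)‖ : ℝ) : ℂ) := fun y => by simp
      simp only [Function.comp_apply, this, integral_complex_ofReal, Complex.ofReal_re]
    have hprod : Integrable (Function.uncurry fun (x y : Fin m → ℝ) =>
        φ x • (Real.exp (-(∑ j, y j ^ 2) / 2) • g (x + y))) (volume.prod volume) := by
      have hφc' := hφ.continuous
      rw [integrable_prod_iff (Continuous.aestronglyMeasurable (by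
        unfold Function.uncurry; fun_prop))]
      refine ⟨Filter.Eventually.of_forall fun x =>
        (integrable_gaussian_smul_translate hf x).smul (φ x), ?_⟩
      have e2 : ∀ x : Fin m → ℝ, ∫ y, ‖Function.uncurry (fun (x y : Fin m → ℝ) =>
          φ x • (Real.exp (-(∑ j, y j ^ 2) / 2) • g (x + y))) (x, y)‖
          = ‖φ x‖ * ∫ y : Fin m → ℝ, Real.exp (-(∑ j, y j ^ 2) / 2) * ‖g (x + y)‖ := by
        intro x
        rw [← integral_const_mul]
        simp [Function.uncurry, norm_smul]
      simp only [e2]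
      exact (hφc'.norm.mul hN').integrable_of_hasCompactSupport hφc.norm.mul_right
    have e3 : ∀ y : Fin m → ℝ, Real.exp (-(∑ j, y j ^ 2) / 2) • ∫ x, φ x • g (x + y)
        = ∫ x, φ x • (Real.exp (-(∑ j, y j ^ 2) / 2) • g (x + y)) := by
      intro y
      rw [← integral_smul]
      exact integral_congr_ae (Filter.Eventually.of_forall fun x => smul_comm _ _ _)
    simp only [e3]
    refine ⟨hprod.integral_prod_right, ?_⟩
    rw [← integral_integral_swap hprod]
    simp only [f, kernelIntegral_ofReal, integral_smul]

end Weak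

/-! ### Homogeneous components of entire functions -/

section OneVariable

variable {E : Type*} [NormedAddCommGroup E] [NormedSpace ℂ E]

/-- The Fourier coefficients of the restriction of a function to the unit circle. -/
def circleCoeff (φ : ℂ → E) (k : ℤ) : E :=
  (2 * Real.pi : ℝ)⁻¹ • ∫ θ in (0 : ℝ)..2 * Real.pi,
    Complex.exp (-(k * θ * Complex.I)) • φ (Complex.exp (θ * Complex.I))

/-- The contour form gives access to Cauchy's theorem for k < 0 and to the Cauchy power series for k
≥ 0. -/
theorem circleCoeff_eq_circleIntegral (φ : ℂ → E) (k : ℤ) :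
    circleCoeff φ k = (2 * Real.pi * Complex.I : ℂ)⁻¹ • ∮ w in C(0, 1), w ^ (-k - 1) • φ w := by
  have h1 : ∀ θ : ℝ, deriv (circleMap 0 1) θ • (circleMap 0 1 θ ^ (-k - 1) • φ (circleMap 0 1 θ))
      = Complex.I • (Complex.exp (-(k * θ * Complex.I)) • φ (Complex.exp (θ * Complex.I))) := by
    intro θ
    have h2 : circleMap 0 1 θ = Complex.exp (θ * Complex.I) := by simp [circleMap]
    rw [deriv_circleMap, h2, smul_smul, smul_smul, ← Complex.exp_int_mul]
    congr 1
    rw [mul_right_comm, ← Complex.exp_add, mul_comm]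
    congr 2
    push_cast
    ring
  rw [circleCoeff, circleIntegral]
  simp only [h1]
  rw [intervalIntegral.integral_smul, smul_smul, ← Complex.coe_smul]
  congr 1
  push_cast
  have := Complex.I_ne_zero
  have hp : (Real.pi : ℂ) ≠ 0 := by exact_mod_cast Real.pi_ne_zero
  field_simp

theorem circleCoeff_of_neg {φ : ℂ → E} (hφ : Differentiable ℂ φ) {k : ℤ} (hk : k < 0) :
    circleCoeff φ k = 0 := by
  obtain ⟨n, hn⟩ := Int.eq_ofNat_of_zero_le (by omega : 0 ≤ -k - 1)
  rw [circleCoeff_eq_circleIntegral, hn]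
  simp only [zpow_natCast]
  have hd : Differentiable ℂ fun w => w ^ n • φ w := by fun_prop
  rw [hd.diffContOnCl.circleIntegral_eq_zero zero_le_one, smul_zero]

theorem circleCoeff_natCast (φ : ℂ → E) (n : ℕ) :
    circleCoeff φ n = cauchyPowerSeries φ 0 1 n fun _ => 1 := by
  rw [circleCoeff_eq_circleIntegral, cauchyPowerSeries_apply]
  congr 1
  refine circleIntegral.integral_congr zero_le_one fun w hw => ?_
  have hw0 : w ≠ 0 := by
    rintro rfl
    simp at hw
  simp only [sub_zero, smul_smul]
  congr 1
  rw [zpow_sub₀ hw0, zpow_neg, zpow_natCast, zpow_one]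
  simp [div_eq_mul_inv]

variable [CompleteSpace E]

theorem hasFPowerSeriesOnBall_cauchy {φ : ℂ → E} (hφ : Differentiable ℂ φ) :
    HasFPowerSeriesOnBall φ (cauchyPowerSeries φ 0 1) 0 ⊤ :=
  hφ.hasFPowerSeriesOnBall 0 (R := 1) one_pos

theorem factorial_smul_circleCoeff {φ : ℂ → E} (hφ : Differentiable ℂ φ) (n : ℕ) :
    n.factorial • circleCoeff φ n = iteratedDeriv n φ 0 := by
  rw [circleCoeff_natCast, (hasFPowerSeriesOnBall_cauchy hφ).factorial_smul,
    iteratedDeriv_eq_iteratedFDeriv]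

theorem hasSum_circleCoeff {φ : ℂ → E} (hφ : Differentiable ℂ φ) :
    HasSum (fun n : ℕ => circleCoeff φ n) (φ 1) := by
  have := (hasFPowerSeriesOnBall_cauchy hφ).hasSum (y := 1) (by simp)
  simpa only [circleCoeff_natCast, zero_add] using this

/-- For entire φ the coefficient is φ⁽ⁿ⁾(0)/n!, so the chain rule settles every complex c, including
those off the unit circle. -/
theorem circleCoeff_comp_mul {φ : ℂ → E} (hφ : Differentiable ℂ φ) (c : ℂ) (n : ℕ) :
    circleCoeff (fun w => φ (c * w)) n = c ^ n • circleCoeff φ n := by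
  have hd : Differentiable ℂ fun w => φ (c * w) := hφ.comp (differentiable_id.const_mul c)
  have h1 := factorial_smul_circleCoeff hd n
  have h2 := factorial_smul_circleCoeff hφ n
  have h3 : ContDiff ℂ n φ := hφ.contDiff
  rw [iteratedDeriv_comp_const_smul h3] at h1
  simp only [mul_zero, ← h2] at h1
  rw [smul_comm] at h1
  rw [← Nat.cast_smul_eq_nsmul ℂ, ← Nat.cast_smul_eq_nsmul ℂ] at h1
  exact smul_right_injective E (Nat.cast_ne_zero.2 (Nat.factorial_ne_zero n) : (n.factorial : ℂ) ≠ 0) h1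

theorem circleCoeff_zpow_smul (j k : ℤ) (v : E) :
    circleCoeff (fun w => w ^ j • v) k = if k = j then v else 0 := by
  have h1 : ∀ θ : ℝ, Complex.exp (-(k * θ * Complex.I)) • (Complex.exp (θ * Complex.I) ^ j • v)
      = Complex.exp (((j - k : ℤ) : ℂ) * Complex.I * θ) • v := by
    intro θ
    rw [smul_smul, ← Complex.exp_int_mul, ← Complex.exp_add]
    congr 2
    push_cast
    ring
  simp only [circleCoeff, h1]
  rw [intervalIntegral.integral_smul_const]
  split_ifs with h
  · subst h
    simp only [sub_self, Int.cast_zero, zero_mul, Complex.exp_zero,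
      intervalIntegral.integral_const, sub_zero]
    rw [smul_assoc, one_smul, smul_smul, inv_mul_cancel₀ (by positivity), one_smul]
  · have hc : ((j - k : ℤ) : ℂ) * Complex.I ≠ 0 :=
      mul_ne_zero (Int.cast_ne_zero.2 (by omega)) Complex.I_ne_zero
    rw [integral_exp_mul_complex hc]
    have h2 : ((j - k : ℤ) : ℂ) * Complex.I * ((2 * Real.pi : ℝ) : ℂ)
        = ((j - k : ℤ) : ℂ) * (2 * Real.pi * Complex.I) := by
      push_cast
      ring
    rw [h2, Complex.exp_int_mul_two_pi_mul_I]
    simp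

/-- Parseval for Fourier series on (0, 2π]. Only continuity on the circle matters, hence the sum
over all integers. -/
theorem hasSum_norm_sq_circleCoeff {φ : ℂ → ℂ} (hφ : Continuous φ) :
    HasSum (fun k : ℤ => ‖circleCoeff φ k‖ ^ 2)
      ((2 * Real.pi)⁻¹ * ∫ θ in (0 : ℝ)..2 * Real.pi, ‖φ (Complex.exp (θ * Complex.I))‖ ^ 2) := by
  have hc : Continuous fun θ : ℝ => φ (Complex.exp (θ * Complex.I)) := by fun_prop
  have hL2 : MemLp (fun θ : ℝ => φ (Complex.exp (θ * Complex.I))) 2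
      (volume.restrict (Set.Ioc 0 (2 * Real.pi))) := by
    have := (hc.locallyIntegrable (μ := volume))
    rw [memLp_two_iff_integrable_sq_norm hc.aestronglyMeasurable]
    exact ((by fun_prop : Continuous fun θ : ℝ =>
      ‖φ (Complex.exp (θ * Complex.I))‖ ^ 2).integrableOn_Ioc)
  have h := hasSum_sq_fourierCoeffOn Real.two_pi_pos hL2
  simp only [sub_zero, smul_eq_mul] at h
  convert h using 3 with k
  rw [circleCoeff, fourierCoeffOn_eq_integral]
  simp only [sub_zero, one_div, fourier_coe_apply]
  congr 1
  congr 1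
  refine congrArg (fun F : ℝ → ℂ => ∫ θ in (0 : ℝ)..2 * Real.pi, F θ) (funext fun θ => ?_)
  congr 2
  have hp : (Real.pi : ℂ) ≠ 0 := by exact_mod_cast Real.pi_ne_zero
  push_cast
  field_simp

end OneVariable

/-! ### Homogeneous components in several variables and their orthogonality -/

section Components

variable {m : ℕ} {E : Type*} [NormedAddCommGroup E] [NormedSpace ℂ E]

/-- The homogeneous component of degree `k`. -/
def homComp (h : (Fin m → ℂ) → E) (k : ℤ) (z : Fin m → ℂ) : E :=
  circleCoeff (fun w => h (w • z)) k

theorem differentiable_comp_smul {h : (Fin m → ℂ) → E} (hh : Differentiable ℂ h) (z : Fin m → ℂ) :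
    Differentiable ℂ fun w : ℂ => h (w • z) := fun w =>
  (hh _).comp w (differentiableAt_id.smul_const z)

theorem homComp_sum {ι : Type*} (S : Finset ι) {p : ι → (Fin m → ℂ) → E}
    (hp : ∀ i ∈ S, Continuous (p i)) (k : ℤ) (z : Fin m → ℂ) :
    homComp (fun z => ∑ i ∈ S, p i z) k z = ∑ i ∈ S, homComp (p i) k z := by
  simp only [homComp, circleCoeff, Finset.smul_sum]
  rw [intervalIntegral.integral_finsetSum, Finset.smul_sum]
  intro i hi
  have := hp i hi
  exact Continuous.intervalIntegrable (by fun_prop) _ _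

variable [FiniteDimensional ℂ E] {h : (Fin m → ℂ) → E}

theorem hasFDerivAt_homComp (hh : Differentiable ℂ h) (k : ℤ) (z : Fin m → ℂ) :
    HasFDerivAt (homComp h k) ((2 * Real.pi : ℝ)⁻¹ • ∫ θ in (0 : ℝ)..2 * Real.pi,
      (Complex.exp (-(k * θ * Complex.I)) * Complex.exp (θ * Complex.I)) •
        fderiv ℂ h (Complex.exp (θ * Complex.I) • z + 0)) z := by
  have := (hasFDerivAt_integral_smul_comp hh (φ := fun θ => Complex.exp (-(k * θ * Complex.I)))
    (c := fun θ => Complex.exp (θ * Complex.I)) (w := fun _ => 0) (by fun_prop) (by fun_prop)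
    continuous_const 0 (2 * Real.pi) z).const_smul (2 * Real.pi : ℝ)⁻¹
  simpa only [add_zero] using! this

theorem differentiable_homComp (hh : Differentiable ℂ h) (k : ℤ) :
    Differentiable ℂ (homComp h k) := fun z => (hasFDerivAt_homComp hh k z).differentiableAt

/-- Differentiating h(exp(iθ)z) produces a factor exp(iθ), which lowers the Fourier index by one.
Integer degrees avoid truncated subtraction here. -/
theorem fderiv_homComp (hh : Differentiable ℂ h) (k : ℤ) (v : Fin m → ℂ) (z : Fin m → ℂ) :
    fderiv ℂ (homComp h k) z v = homComp (fun z => fderiv ℂ h z v) (k - 1) z := by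
  have : CompleteSpace E := FiniteDimensional.complete ℂ E
  have hc : Continuous (fderiv ℂ h) := (contDiff_of_differentiable hh).continuous_fderiv (by simp)
  rw [(hasFDerivAt_homComp hh k z).fderiv, smul_apply,
    ContinuousLinearMap.intervalIntegral_apply (Continuous.intervalIntegrable (by fun_prop) _ _)]
  rw [homComp, circleCoeff]
  congr 1
  congr 1
  funext θ
  rw [smul_apply, add_zero, ← Complex.exp_add]
  congr 2
  push_cast
  ring

theorem homComp_of_neg (hh : Differentiable ℂ h) {k : ℤ} (hk : k < 0) (z : Fin m → ℂ) :
    homComp h k z = 0 :=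
  have : CompleteSpace E := FiniteDimensional.complete ℂ E
  circleCoeff_of_neg (differentiable_comp_smul hh z) hk

theorem homComp_smul (hh : Differentiable ℂ h) (n : ℕ) (c : ℂ) (z : Fin m → ℂ) :
    homComp h n (c • z) = c ^ n • homComp h n z := by
  have : CompleteSpace E := FiniteDimensional.complete ℂ E
  rw [homComp, homComp, ← circleCoeff_comp_mul (differentiable_comp_smul hh z)]
  simp only [smul_smul, mul_comm]

theorem hasSum_homComp (hh : Differentiable ℂ h) (z : Fin m → ℂ) :
    HasSum (fun n : ℕ => homComp h n z) (h z) := by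
  have : CompleteSpace E := FiniteDimensional.complete ℂ E
  simpa only [one_smul] using! hasSum_circleCoeff (differentiable_comp_smul hh z)

/-- Homogeneity reduces the bound to compactness of the unit ball; scaling by 1 + ‖z‖ instead of ‖z‖
avoids a case distinction at 0. -/
theorem exists_norm_homComp_le (hh : Differentiable ℂ h) (k : ℤ) :
    ∃ C, 0 ≤ C ∧ ∀ z, ‖homComp h k z‖ ≤ C * (1 + ‖z‖) ^ k.toNat := by
  rcases lt_or_ge k 0 with hk | hk
  · exact ⟨0, le_rfl, fun z => by simp [homComp_of_neg hh hk]⟩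
  obtain ⟨n, rfl⟩ := Int.eq_ofNat_of_zero_le hk
  obtain ⟨C, hC⟩ := (isCompact_closedBall (0 : Fin m → ℂ) 1).exists_bound_of_continuousOn
    (differentiable_homComp hh n).continuous.continuousOn
  have hC0 : 0 ≤ C := (norm_nonneg _).trans (hC 0 (by simp))
  refine ⟨C, hC0, fun z => ?_⟩
  have hz : z = ((1 + ‖z‖ : ℝ) : ℂ) • (((1 + ‖z‖ : ℝ) : ℂ)⁻¹ • z) := by
    rw [smul_smul, mul_inv_cancel₀, one_smul]
    exact_mod_cast (by positivity : (1 + ‖z‖) ≠ 0)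
  have hn : ‖((1 + ‖z‖ : ℝ) : ℂ)‖ = 1 + ‖z‖ := by
    rw [Complex.norm_real, Real.norm_eq_abs, abs_of_nonneg (by positivity)]
  rw [hz, homComp_smul hh, norm_smul, norm_pow, hn, ← hz, mul_comm, Int.toNat_natCast]
  refine mul_le_mul_of_nonneg_right (hC _ ?_) (by positivity)
  rw [mem_closedBall_zero_iff, norm_smul, norm_inv, hn, inv_mul_le_iff₀ (by positivity)]
  linarith

theorem homComp_homComp (hh : Differentiable ℂ h) (n : ℕ) (k : ℤ) (z : Fin m → ℂ) :
    homComp (homComp h n) k z = if k = n then homComp h n z else 0 := by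
  have : CompleteSpace E := FiniteDimensional.complete ℂ E
  have h1 : homComp (homComp h n) k z = circleCoeff (fun w => w ^ (n : ℤ) • homComp h n z) k := by
    rw [homComp]
    simp only [homComp_smul hh, zpow_natCast]
  rw [h1, circleCoeff_zpow_smul]

theorem clm_homComp {F : Type*} [NormedAddCommGroup F] [NormedSpace ℂ F] [FiniteDimensional ℂ F]
    (L : E →L[ℂ] F) (hh : Continuous h) (k : ℤ) (z : Fin m → ℂ) :
    L (homComp h k z) = homComp (fun z => L (h z)) k z := by
  have : CompleteSpace E := FiniteDimensional.complete ℂ E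
  have : CompleteSpace F := FiniteDimensional.complete ℂ F
  rw [homComp, homComp, circleCoeff, circleCoeff, ← Complex.coe_smul, map_smul, Complex.coe_smul,
    ← ContinuousLinearMap.intervalIntegral_comp_comm]
  · simp
  · exact Continuous.intervalIntegrable (by fun_prop) _ _

theorem hasSum_norm_sq_homComp {h : (Fin m → ℂ) → ComplexClifford m} (hh : Continuous h)
    (z : Fin m → ℂ) : HasSum (fun k : ℤ => ‖homComp h k z‖ ^ 2)
      ((2 * Real.pi)⁻¹ * ∫ θ in (0 : ℝ)..2 * Real.pi, ‖h (Complex.exp (θ * Complex.I) • z)‖ ^ 2) := by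
  simp only [norm_sq_eq_sum_coeff, clm_homComp _ hh]
  rw [intervalIntegral.integral_finsetSum fun A _ =>
    Continuous.intervalIntegrable (by fun_prop) _ _, Finset.mul_sum]
  exact hasSum_sum fun A _ => hasSum_norm_sq_circleCoeff
    (φ := fun w => coeffCLM A (h (w • z))) (by fun_prop)

/-- Mean of the squared norm over circles, in terms of homogeneous components. -/
theorem lintegral_weight_norm_sq {h : (Fin m → ℂ) → ComplexClifford m} (hh : Differentiable ℂ h) :
    ∫⁻ z : Fin m → ℂ, ENNReal.ofReal (Real.exp (-∑ j, ‖z j‖ ^ 2)) * ‖h z‖ₑ ^ 2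
      = ∑' n : ℕ, ∫⁻ z : Fin m → ℂ, ENNReal.ofReal (Real.exp (-∑ j, ‖z j‖ ^ 2)) *
        ‖homComp h n z‖ₑ ^ 2 := by
  have hc := hh.continuous
  set W : (Fin m → ℂ) → ENNReal := fun z => ENNReal.ofReal (Real.exp (-∑ j, ‖z j‖ ^ 2)) with hW
  have hWm : Measurable W := by fun_prop
  -- Both the Gaussian weight and Lebesgue measure are invariant under z ↦ exp(iθ)z, so the integral
  -- of |h|² may be averaged over θ.
  have hrot : ∀ θ : ℝ, ∫⁻ z, W z * ‖h (Complex.exp (θ * Complex.I) • z)‖ₑ ^ 2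
      = ∫⁻ z, W z * ‖h z‖ₑ ^ 2 := by
    intro θ
    have hmp : MeasurePreserving (fun z : Fin m → ℂ => Complex.exp (θ * Complex.I) • z) :=
      volume_preserving_pi fun _ => (rotation (Circle.exp θ)).measurePreserving
    rw [← hmp.lintegral_comp (f := fun z => W z * ‖h z‖ₑ ^ 2)
      (hWm.mul (by fun_prop : Continuous fun z => ‖h z‖ₑ ^ 2).measurable)]
    refine lintegral_congr fun z => ?_
    have hWz : W (Complex.exp (θ * Complex.I) • z) = W z := by
      simp [hW, Complex.norm_exp_ofReal_mul_I]
    simp only [hWz]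
  -- Parseval on the circle through z; negative degrees vanish for entire h, so the sum runs over ℕ.
  have hpt : ∀ z, ∑' n : ℕ, ‖homComp h n z‖ₑ ^ 2
      = ENNReal.ofReal (2 * Real.pi)⁻¹ * ∫⁻ θ in Set.Ioc (0 : ℝ) (2 * Real.pi),
        ‖h (Complex.exp (θ * Complex.I) • z)‖ₑ ^ 2 := by
    intro z
    have h1 := hasSum_norm_sq_homComp hc z
    have h2 : HasSum (fun n : ℕ => ‖homComp h n z‖ ^ 2) _ :=
      (Nat.cast_injective (R := ℤ)).hasSum_iff (f := fun k : ℤ => ‖homComp h k z‖ ^ 2)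
        (fun k hk => by
          have : k < 0 := by
            by_contra hk'
            exact hk ⟨k.toNat, by simpa using not_lt.1 hk'⟩
          simp [homComp_of_neg hh this]) |>.2 h1
    have hci : Continuous fun θ : ℝ => ‖h (Complex.exp (θ * Complex.I) • z)‖ ^ 2 := by fun_prop
    have h3 : ENNReal.ofReal (∫ θ in (0 : ℝ)..2 * Real.pi,
        ‖h (Complex.exp (θ * Complex.I) • z)‖ ^ 2) = ∫⁻ θ in Set.Ioc (0 : ℝ) (2 * Real.pi),
        ‖h (Complex.exp (θ * Complex.I) • z)‖ₑ ^ 2 := by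
      rw [intervalIntegral.integral_of_le Real.two_pi_pos.le,
        ofReal_integral_eq_lintegral_ofReal hci.integrableOn_Ioc
          (Filter.Eventually.of_forall fun θ => by positivity)]
      simp only [ENNReal.ofReal_pow (norm_nonneg _), ofReal_norm]
    rw [← h3, ← ENNReal.ofReal_mul (by positivity), ← h2.tsum_eq,
      ENNReal.ofReal_tsum_of_nonneg (fun n => by positivity) h2.summable]
    simp only [ENNReal.ofReal_pow (norm_nonneg _), ofReal_norm]
  have hcm : ∀ n : ℕ, Measurable fun z : Fin m → ℂ => W z * ‖homComp h n z‖ₑ ^ 2 := fun n => by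
    have := (differentiable_homComp hh n).continuous
    exact hWm.mul (by fun_prop : Continuous fun z => ‖homComp h n z‖ₑ ^ 2).measurable
  rw [← lintegral_tsum fun n => (hcm n).aemeasurable]
  simp only [ENNReal.tsum_mul_left, hpt]
  have hmeas : Measurable (Function.uncurry fun (z : Fin m → ℂ) (θ : ℝ) =>
      W z * ‖h (Complex.exp (θ * Complex.I) • z)‖ₑ ^ 2) := by
    refine (hWm.comp measurable_fst).mul ?_
    exact (by fun_prop : Continuous fun p : (Fin m → ℂ) × ℝ =>
      ‖h (Complex.exp (p.2 * Complex.I) • p.1)‖ₑ ^ 2).measurable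
  have h5 : ∀ z, W z * (ENNReal.ofReal (2 * Real.pi)⁻¹ * ∫⁻ θ in Set.Ioc (0 : ℝ) (2 * Real.pi),
      ‖h (Complex.exp (θ * Complex.I) • z)‖ₑ ^ 2) = ENNReal.ofReal (2 * Real.pi)⁻¹ *
      ∫⁻ θ in Set.Ioc (0 : ℝ) (2 * Real.pi), W z *
        ‖h (Complex.exp (θ * Complex.I) • z)‖ₑ ^ 2 := by
    intro z
    rw [lintegral_const_mul' _ _ ENNReal.ofReal_ne_top]
    ring
  simp only [h5]
  rw [lintegral_const_mul' _ _ ENNReal.ofReal_ne_top,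
    lintegral_lintegral_swap hmeas.aemeasurable]
  simp only [hrot]
  rw [lintegral_const, Measure.restrict_apply_univ, Real.volume_Ioc, sub_zero, mul_comm, mul_assoc,
    ← ENNReal.ofReal_mul (by positivity), mul_inv_cancel₀ (by positivity), ENNReal.ofReal_one,
    mul_one]

end Components

/-! ### Gaussian averages of polyharmonic functions of polynomial growth -/

section Heat

variable {m : ℕ} {E : Type*} [NormedAddCommGroup E]

/-- Functions of polynomial growth. -/
def PolyGrowth (f : (Fin m → ℝ) → E) : Prop :=
  ∃ C : ℝ, ∃ N : ℕ, 0 ≤ C ∧ ∀ x, ‖f x‖ ≤ C * (1 + ‖x‖) ^ N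

/-- The Gaussian weight `exp(-|x|²/2)`. -/
def gaussWeight (x : Fin m → ℝ) : ℝ := Real.exp (-(∑ j, x j ^ 2) / 2)

theorem contDiff_gaussWeight : ContDiff ℝ (⊤ : ℕ∞) (gaussWeight (m := m)) := by
  unfold gaussWeight
  fun_prop

theorem gaussWeight_pos (x : Fin m → ℝ) : 0 < gaussWeight x := Real.exp_pos _

theorem fderiv_gaussWeight (x : Fin m → ℝ) (j : Fin m) :
    fderiv ℝ gaussWeight x (Pi.single j 1) = -(x j * gaussWeight x) := by
  have hp : ∀ i, HasFDerivAt (fun x : Fin m → ℝ => x i)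
      (ContinuousLinearMap.proj i : (Fin m → ℝ) →L[ℝ] ℝ) x := fun i => hasFDerivAt_apply i x
  have h1 : HasFDerivAt (fun x : Fin m → ℝ => ∑ i, x i ^ 2) _ x :=
    HasFDerivAt.fun_sum fun i _ => (hp i).pow 2
  have h2 := ((h1.neg.mul_const (2⁻¹ : ℝ))).exp
  have h3 : (gaussWeight : (Fin m → ℝ) → ℝ) = fun x => Real.exp ((-fun x => ∑ i, x i ^ 2) x * 2⁻¹) := by
    funext y
    simp [gaussWeight, div_eq_mul_inv]
  rw [h3, h2.fderiv]
  simp [Pi.single_apply]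
  ring

/-- From (1 + r)^N ≤ N! exp(1 + r), the power is absorbed by an exponential. The parameter 1/2 is
chosen so that the square of the function in `memLp_exp_sub_sq` is exp(∑|x_j| - |x|²/2). -/
theorem integrable_gaussWeight_mul_pow (N : ℕ) :
    Integrable fun x : Fin m → ℝ => gaussWeight x * (1 + ‖x‖) ^ N := by
  have h1 := (memLp_two_iff_integrable_sq
    (memLp_exp_sub_sq (m := m) (1 / 2)).aestronglyMeasurable).1 (memLp_exp_sub_sq (m := m) (1 / 2))
  refine (h1.const_mul (N.factorial * Real.exp 1)).mono'
    (Continuous.aestronglyMeasurable ?_) (Filter.Eventually.of_forall fun x => ?_)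
  · exact contDiff_gaussWeight.continuous.mul (by fun_prop)
  have hx : ‖x‖ ≤ ∑ j, |x j| := by
    refine (pi_norm_le_iff_of_nonneg (Finset.sum_nonneg fun j _ => abs_nonneg _)).2 fun j => ?_
    exact Finset.single_le_sum (f := fun j => |x j|) (fun j _ => abs_nonneg _) (Finset.mem_univ j)
  have h2 : (1 + ‖x‖) ^ N ≤ N.factorial * Real.exp (1 + ∑ j, |x j|) := by
    have h3 := Real.pow_div_factorial_le_exp (1 + ‖x‖) (by positivity) N
    rw [div_le_iff₀ (by positivity)] at h3
    calc _ ≤ _ := h3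
      _ ≤ Real.exp (1 + ∑ j, |x j|) * N.factorial := by gcongr
      _ = _ := mul_comm _ _
  rw [Real.norm_eq_abs, abs_of_nonneg (mul_nonneg (gaussWeight_pos x).le (by positivity))]
  calc gaussWeight x * (1 + ‖x‖) ^ N
      ≤ gaussWeight x * (N.factorial * Real.exp (1 + ∑ j, |x j|)) :=
        mul_le_mul_of_nonneg_left h2 (gaussWeight_pos x).le
    _ = _ := by
        rw [gaussWeight, ← Real.exp_nat_mul, Real.exp_add, mul_left_comm, mul_assoc,
          mul_left_comm (Real.exp (-(∑ j, x j ^ 2) / 2)), ← Real.exp_add]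
        congr 3
        push_cast
        ring

/-- The constants are uniform in |τ| ≤ T, as domination of a τ-derivative requires. -/
theorem PolyGrowth.comp_affine {f : (Fin m → ℝ) → E} (hf : PolyGrowth f) (x₀ : Fin m → ℝ) (T : ℝ) :
    ∃ C : ℝ, ∃ N : ℕ, 0 ≤ C ∧ ∀ τ, |τ| ≤ T → ∀ x, ‖f (x₀ + τ • x)‖ ≤ C * (1 + ‖x‖) ^ N := by
  obtain ⟨C, N, hC, h⟩ := hf
  refine ⟨C * (1 + ‖x₀‖ + |T|) ^ N, N, by positivity, fun τ hτ x => (h _).trans ?_⟩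
  rw [mul_assoc, ← mul_pow]
  gcongr
  have h1 : ‖x₀ + τ • x‖ ≤ ‖x₀‖ + |T| * ‖x‖ := by
    refine (norm_add_le _ _).trans ?_
    rw [norm_smul, Real.norm_eq_abs]
    exact add_le_add_right (mul_le_mul_of_nonneg_right (hτ.trans (le_abs_self T))
      (norm_nonneg x)) _
  nlinarith [norm_nonneg x₀, norm_nonneg x, abs_nonneg T,
    mul_nonneg (norm_nonneg x₀) (norm_nonneg x)]

theorem PolyGrowth.comp {f : (Fin m → ℝ) → E} (hf : PolyGrowth f) (x₀ : Fin m → ℝ) (τ : ℝ) :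
    PolyGrowth fun x => f (x₀ + τ • x) := by
  obtain ⟨C, N, hC, h⟩ := hf.comp_affine x₀ |τ|
  exact ⟨C, N, hC, h τ le_rfl⟩

variable [NormedSpace ℝ E]

theorem PolyGrowth.coord_smul {f : (Fin m → ℝ) → E} (hf : PolyGrowth f) (j : Fin m) :
    PolyGrowth fun x => x j • f x := by
  obtain ⟨C, N, hC, h⟩ := hf
  refine ⟨C, N + 1, hC, fun x => ?_⟩
  rw [norm_smul, pow_succ', mul_left_comm]
  gcongr
  · exact (norm_le_pi_norm x j).trans (by linarith)
  · exact h x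

theorem PolyGrowth.integrable {f : (Fin m → ℝ) → E} (hf : PolyGrowth f) (hc : Continuous f) :
    Integrable fun x => gaussWeight x • f x := by
  obtain ⟨C, N, hC, h⟩ := hf
  refine ((integrable_gaussWeight_mul_pow N).const_mul C).mono'
    (contDiff_gaussWeight.continuous.smul hc).aestronglyMeasurable
    (Filter.Eventually.of_forall fun x => ?_)
  rw [norm_smul, Real.norm_eq_abs, abs_of_pos (gaussWeight_pos x), mul_left_comm]
  exact mul_le_mul_of_nonneg_left (h x) (gaussWeight_pos x).le

/-- The partial derivative of a function on `ℝ^m`. -/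
def partialD (j : Fin m) (u : (Fin m → ℝ) → E) (x : Fin m → ℝ) : E := fderiv ℝ u x (Pi.single j 1)

theorem contDiff_partialD {u : (Fin m → ℝ) → E} (hu : ContDiff ℝ (⊤ : ℕ∞) u) (j : Fin m) :
    ContDiff ℝ (⊤ : ℕ∞) (partialD j u) :=
  (contDiff_infty_iff_fderiv.1 hu).2.clm_apply contDiff_const

theorem hasFDerivAt_comp_affine {u : (Fin m → ℝ) → E} (hu : ContDiff ℝ (⊤ : ℕ∞) u)
    (x₀ : Fin m → ℝ) (τ : ℝ) (x : Fin m → ℝ) :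
    HasFDerivAt (fun x => u (x₀ + τ • x)) (τ • fderiv ℝ u (x₀ + τ • x)) x := by
  have h1 : HasFDerivAt (fun x : Fin m → ℝ => x₀ + τ • x)
      (τ • ContinuousLinearMap.id ℝ (Fin m → ℝ)) x :=
    ((hasFDerivAt_id x).const_smul τ).const_add x₀
  refine ((hu.differentiable (by simp) _).hasFDerivAt.comp x h1).congr_fderiv ?_
  ext v
  simp

/-- Gaussian integration by parts: x_j times the weight is minus its j-th derivative, and the factor
τ is the chain rule. -/
theorem integral_coord_smul_gaussWeight {u : (Fin m → ℝ) → E} (hu : ContDiff ℝ (⊤ : ℕ∞) u)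
    (j : Fin m) (h0 : PolyGrowth u) (h1 : PolyGrowth (partialD j u)) (x₀ : Fin m → ℝ) (τ : ℝ) :
    ∫ x, gaussWeight x • x j • u (x₀ + τ • x)
      = τ • ∫ x, gaussWeight x • partialD j u (x₀ + τ • x) := by
  have haff : Continuous fun x : Fin m → ℝ => x₀ + τ • x := by fun_prop
  have hc := hu.continuous.comp haff
  have hc1 := (contDiff_partialD hu j).continuous.comp haff
  have e1 : ∀ x, fderiv ℝ (fun x => u (x₀ + τ • x)) x (Pi.single j 1)
      = τ • partialD j u (x₀ + τ • x) := fun x => by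
    rw [(hasFDerivAt_comp_affine hu x₀ τ x).fderiv]
    rfl
  have e2 : ∀ x, fderiv ℝ gaussWeight x (Pi.single j 1) • u (x₀ + τ • x)
      = -(gaussWeight x • x j • u (x₀ + τ • x)) := fun x => by
    rw [fderiv_gaussWeight, neg_smul, smul_smul, mul_comm]
  have i1 := ((h0.comp x₀ τ).coord_smul j).integrable ((continuous_apply j).smul hc)
  have i2 := ((h1.comp x₀ τ).integrable hc1).smul τ
  have i2' : Integrable fun x => gaussWeight x • fderiv ℝ (fun x => u (x₀ + τ • x)) x
      (Pi.single j 1) := by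
    simp only [e1]
    exact i2.congr (Filter.Eventually.of_forall fun x => smul_comm _ _ _)
  have i1' : Integrable fun x => fderiv ℝ gaussWeight x (Pi.single j 1) • u (x₀ + τ • x) := by
    simp only [e2]
    exact i1.neg
  have key := integral_smul_fderiv_eq_neg_fderiv_smul_of_integrable (μ := volume)
    (f := gaussWeight) (g := fun x => u (x₀ + τ • x)) (v := Pi.single j 1) i1' i2'
    ((h0.comp x₀ τ).integrable hc)
    (fun x _ => contDiff_gaussWeight.differentiable (by simp) x)
    (fun x _ => (hasFDerivAt_comp_affine hu x₀ τ x).differentiableAt)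
  simp only [e1, e2, integral_neg, neg_neg] at key
  rw [← key, ← integral_smul]
  exact integral_congr_ae (Filter.Eventually.of_forall fun x => smul_comm _ _ _)

/-- The heat equation in the time variable τ²/2. The chain rule gives ∑ x_j ∂_j u under the
integral, and Gaussian integration by parts turns this into τ Δu; v stands for -Δu. -/
theorem hasDerivAt_gaussAverage {u v : (Fin m → ℝ) → E} (hu : ContDiff ℝ (⊤ : ℕ∞) u)
    (h0 : PolyGrowth u) (h1 : ∀ j, PolyGrowth (partialD j u))
    (h2 : ∀ j, PolyGrowth (partialD j (partialD j u)))
    (hv : ∀ x, v x = -∑ j, partialD j (partialD j u) x) (x₀ : Fin m → ℝ) (τ : ℝ) :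
    HasDerivAt (fun τ => ∫ x, gaussWeight x • u (x₀ + τ • x))
      (-(τ • ∫ x, gaussWeight x • v (x₀ + τ • x))) τ := by
  have haff : ∀ τ : ℝ, Continuous fun x : Fin m → ℝ => x₀ + τ • x := fun τ => by fun_prop
  have hc1 := fun j => (contDiff_partialD hu j).continuous
  have hc2 := fun j => (contDiff_partialD (contDiff_partialD hu j) j).continuous
  choose C N hC hCN using fun j => (h1 j).comp_affine x₀ (|τ| + 1)
  have hF' : ∀ τ : ℝ, ∀ x : Fin m → ℝ, HasDerivAt (fun τ : ℝ => gaussWeight x • u (x₀ + τ • x))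
      (∑ j, gaussWeight x • x j • partialD j u (x₀ + τ • x)) τ := by
    intro τ x
    have hl : HasDerivAt (fun τ : ℝ => x₀ + τ • x) x τ := by
      simpa using ((hasDerivAt_id τ).smul_const x).const_add x₀
    have h3 := ((hu.differentiable (by simp) (x₀ + τ • x)).hasFDerivAt.comp_hasDerivAt τ hl).const_smul
      (gaussWeight x)
    refine h3.congr_deriv ?_
    rw [← Finset.smul_sum]
    congr 1
    simp only [partialD]
    generalize fderiv ℝ u (x₀ + τ • x) = L
    conv_lhs => rw [← Finset.univ_sum_single x, map_sum]
    refine Finset.sum_congr rfl fun j _ => ?_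
    rw [← map_smul, ← Pi.single_smul, smul_eq_mul, mul_one]
  have hd := (hasDerivAt_integral_of_dominated_loc_of_deriv_le (μ := volume)
    (F := fun (τ : ℝ) (x : Fin m → ℝ) => gaussWeight x • u (x₀ + τ • x))
    (F' := fun (τ : ℝ) (x : Fin m → ℝ) => ∑ j, gaussWeight x • x j • partialD j u (x₀ + τ • x))
    (bound := fun x => ∑ j, C j * (gaussWeight x * (1 + ‖x‖) ^ (N j + 1)))
    (x₀ := τ) (Metric.ball_mem_nhds τ one_pos)
    (Filter.Eventually.of_forall fun τ => ((h0.comp x₀ τ).integrable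
      (hu.continuous.comp (haff τ))).aestronglyMeasurable)
    ((h0.comp x₀ τ).integrable (hu.continuous.comp (haff τ))) ?_ ?_ ?_ ?_).2
  · refine hd.congr_deriv ?_
    rw [integral_finsetSum _ fun j _ => (((h1 j).comp x₀ τ).coord_smul j).integrable
      ((continuous_apply j).smul ((hc1 j).comp (haff τ)))]
    simp only [fun j => integral_coord_smul_gaussWeight (contDiff_partialD hu j) j (h1 j) (h2 j) x₀ τ]
    rw [← Finset.smul_sum, ← integral_finsetSum _ fun j _ => ((h2 j).comp x₀ τ).integrable
      ((hc2 j).comp (haff τ)), ← smul_neg, ← integral_neg]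
    simp only [hv, smul_neg, neg_neg, Finset.smul_sum]
  · refine Continuous.aestronglyMeasurable ?_
    exact continuous_finsetSum _ fun j _ => contDiff_gaussWeight.continuous.smul
      ((continuous_apply j).smul ((hc1 j).comp (haff τ)))
  · refine Filter.Eventually.of_forall fun x t ht => norm_sum_le_of_le _ fun j _ => ?_
    have ht' : |t| ≤ |τ| + 1 := by
      have := abs_sub_abs_le_abs_sub t τ
      rw [Metric.mem_ball, Real.dist_eq] at ht
      linarith
    rw [norm_smul, norm_smul, Real.norm_eq_abs, abs_of_pos (gaussWeight_pos x),
      mul_left_comm (C j), pow_succ']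
    refine mul_le_mul_of_nonneg_left ?_ (gaussWeight_pos x).le
    rw [mul_left_comm (C j)]
    have := (norm_le_pi_norm x j).trans (by linarith : ‖x‖ ≤ 1 + ‖x‖)
    have h4 := hCN j t ht' x
    gcongr
  · exact integrable_finsetSum _ fun j _ => (integrable_gaussWeight_mul_pow _).const_mul _
  · exact Filter.Eventually.of_forall fun x t _ => hF' t x

/-- The coefficients of the exponential series at `1 / 2`. -/
def heatCoeff (k : ℕ) : ℝ := (2 ^ k * k.factorial : ℝ)⁻¹

theorem two_mul_succ_mul_heatCoeff (k : ℕ) : 2 * (k + 1) * heatCoeff (k + 1) = heatCoeff k := by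
  rw [heatCoeff, heatCoeff, Nat.factorial_succ]
  push_cast
  have : (k.factorial : ℝ) ≠ 0 := by positivity
  field_simp
  ring

/-- The inverse heat operator is inverted by the Gaussian average. -/
theorem sum_heatCoeff_smul_gaussAverage [CompleteSpace E] {u : ℕ → (Fin m → ℝ) → E} {s : ℕ}
    (hu : ∀ k, ContDiff ℝ (⊤ : ℕ∞) (u k)) (h0 : ∀ k, PolyGrowth (u k))
    (h1 : ∀ k j, PolyGrowth (partialD j (u k)))
    (h2 : ∀ k j, PolyGrowth (partialD j (partialD j (u k))))
    (hv : ∀ k x, u (k + 1) x = -∑ j, partialD j (partialD j (u k)) x)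
    (hs : ∀ x, u s x = 0) (x₀ : Fin m → ℝ) :
    ∑ k ∈ Finset.range s, heatCoeff k • ∫ x, gaussWeight x • u k (x₀ + x)
      = (∫ x : Fin m → ℝ, gaussWeight x) • u 0 x₀ := by
  set A : ℕ → ℝ → E := fun k τ => ∫ x, gaussWeight x • u k (x₀ + τ • x) with hA
  have hA' : ∀ k τ, HasDerivAt (A k) (-(τ • A (k + 1) τ)) τ := fun k τ =>
    hasDerivAt_gaussAverage (hu k) (h0 k) (h1 k) (h2 k) (hv k) x₀ τ
  have hAs : ∀ τ, A s τ = 0 := fun τ => by simp [hA, hs]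
  -- The derivative of the k-th term is B τ k - B τ (k+1), because 2(k+1) times the coefficient of
  -- index k+1 is the coefficient of index k. The telescoped sum is zero: B τ 0 = 0 by definition
  -- and B τ s = 0 since the s-th average vanishes.
  let B : ℝ → ℕ → E := fun τ k =>
    Nat.casesOn k 0 fun k => (heatCoeff k * τ ^ (2 * k + 1)) • A (k + 1) τ
  have hterm : ∀ k τ, HasDerivAt (fun τ => (heatCoeff k * τ ^ (2 * k)) • A k τ)
      (B τ k - B τ (k + 1)) τ := by
    intro k τ
    have h3 := ((hasDerivAt_pow (2 * k) τ).const_mul (heatCoeff k)).smul (hA' k τ)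
    refine h3.congr_deriv ?_
    cases k with
    | zero => simp [B, smul_smul]
    | succ k =>
      have e1 : heatCoeff (k + 1) * (((2 * (k + 1) : ℕ) : ℝ) * τ ^ (2 * (k + 1) - 1))
          = heatCoeff k * τ ^ (2 * k + 1) := by
        rw [← two_mul_succ_mul_heatCoeff k, show 2 * (k + 1) - 1 = 2 * k + 1 by omega]
        push_cast
        ring
      simp only [B, e1]
      rw [smul_neg, smul_smul, neg_add_eq_sub]
      congr 2
      ring
  have hΦ : ∀ τ, HasDerivAt
      (fun τ => ∑ k ∈ Finset.range s, (heatCoeff k * τ ^ (2 * k)) • A k τ) 0 τ := by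
    intro τ
    refine (HasDerivAt.fun_sum fun k _ => hterm k τ).congr_deriv ?_
    rw [Finset.sum_range_sub']
    cases s with
    | zero => simp [B]
    | succ s => simp [B, hAs]
  -- At τ = 1 the constant function is the sum of Gaussian averages; at τ = 0 only the term k = 0
  -- survives and the integrand is u 0 x₀ times the weight.
  have hconst := is_const_of_deriv_eq_zero (fun τ => (hΦ τ).differentiableAt)
    (fun τ => (hΦ τ).deriv) 1 0
  simp only [one_pow, mul_one] at hconst
  have e3 : ∀ k, A k 1 = ∫ x, gaussWeight x • u k (x₀ + x) := fun k => by simp [hA]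
  simp only [e3] at hconst
  rw [hconst]
  cases s with
  | zero => simp [hs]
  | succ s =>
    rw [Finset.sum_range_succ', Finset.sum_eq_zero fun k _ => by simp]
    simpa [hA, heatCoeff] using integral_smul_const (μ := volume) gaussWeight (u 0 x₀)

theorem integral_gaussWeight :
    ∫ x : Fin m → ℝ, gaussWeight x = (2 * Real.pi) ^ ((m : ℝ) / 2) := by
  have h2 : ∀ x : Fin m → ℝ, gaussWeight x = ∏ j, Real.exp (-(1 / 2) * x j ^ 2) := by
    intro x
    rw [gaussWeight, ← Real.exp_sum, ← Finset.mul_sum]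
    congr 1
    ring
  simp only [h2]
  rw [integral_fintype_prod_volume_eq_pow (fun t : ℝ => Real.exp (-(1 / 2) * t ^ 2)),
    integral_gaussian, Fintype.card_fin, Real.sqrt_eq_rpow, ← Real.rpow_natCast,
    ← Real.rpow_mul (by positivity)]
  congr 1 <;> ring

end Heat

/-! ### The preimage of a homogeneous `s`-monogenic polynomial -/

section Inverse

variable {m : ℕ}

theorem fderiv_fderiv_apply {h : (Fin m → ℂ) → ComplexClifford m} (hh : Differentiable ℂ h)
    (z v w : Fin m → ℂ) :
    fderiv ℂ (fun z => fderiv ℂ h z v) z w = fderiv ℂ (fderiv ℂ h) z w v := by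
  have h1 : Differentiable ℂ (fderiv ℂ h) :=
    (contDiff_infty_iff_fderiv.1 (contDiff_of_differentiable hh)).2.differentiable (by simp)
  have h2 := ((h1 z).hasFDerivAt.clm_apply (hasFDerivAt_const v z)).fderiv
  rw [h2]
  simp

/-- The square of the Dirac operator is the negative Laplacian. -/
theorem complexDiracOp_complexDiracOp {h : (Fin m → ℂ) → ComplexClifford m}
    (hh : Differentiable ℂ h) (z : Fin m → ℂ) :
    complexDiracOp (complexDiracOp h) z
      = -∑ j, fderiv ℂ (fun z => fderiv ℂ h z (Pi.single j 1)) z (Pi.single j 1) := by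
  set D : Fin m → Fin m → ComplexClifford m :=
    fun i j => fderiv ℂ (fun z => fderiv ℂ h z (Pi.single j 1)) z (Pi.single i 1) with hD
  have hsymm : ∀ i j, D i j = D j i := by
    intro i j
    simp only [hD, fderiv_fderiv_apply hh]
    exact ((contDiff_of_differentiable hh).contDiffAt.isSymmSndFDerivAt
      (by simpa using WithTop.coe_le_coe.2 (le_top : (2 : ℕ∞) ≤ ⊤))) _ _
  have h1 : complexDiracOp (complexDiracOp h) z
      = ∑ i, ∑ j, cliffordGen i * cliffordGen j * D i j := by
    rw [complexDiracOp]
    refine Finset.sum_congr rfl fun i _ => ?_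
    have h2 : HasFDerivAt (complexDiracOp h) (∑ j, (leftMul (cliffordGen j)).comp
        (fderiv ℂ (fun z => fderiv ℂ h z (Pi.single j 1)) z)) z :=
      HasFDerivAt.fun_sum fun j _ => (leftMul (cliffordGen j)).hasFDerivAt.comp z
        (differentiable_fderiv_apply hh (Pi.single j 1) z).hasFDerivAt
    rw [h2.fderiv]
    simp [hD, Finset.mul_sum, mul_assoc]
  -- Symmetry of second derivatives allows the generators to be interchanged. Adding the two forms
  -- brings in the anticommutator, which leaves -2 times the diagonal.
  have h3 : ∑ i, ∑ j, cliffordGen i * cliffordGen j * D i j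
      = ∑ i, ∑ j, cliffordGen j * cliffordGen i * D i j := by
    rw [Finset.sum_comm]
    simp only [hsymm]
  have h4 : (2 : ℂ) • complexDiracOp (complexDiracOp h) z = (2 : ℂ) • -∑ j, D j j := by
    rw [two_smul]
    refine (congrArg₂ (· + ·) h1 (h1.trans h3)).trans ?_
    simp only [← Finset.sum_add_distrib, ← add_mul, cliffordGen_mul_add_swap, ite_mul, zero_mul,
      Finset.sum_ite_eq, Finset.mem_univ, if_true]
    rw [← Finset.mul_sum, smul_neg, neg_mul, two_smul, two_mul]
  exact smul_right_injective _ two_ne_zero h4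

theorem complexDiracOp_zero : complexDiracOp (0 : (Fin m → ℂ) → ComplexClifford m) = 0 := by
  funext z
  simp [complexDiracOp]

theorem complexDiracOp_iterate_zero (n : ℕ) :
    complexDiracOp^[n] (0 : (Fin m → ℂ) → ComplexClifford m) = 0 :=
  Function.iterate_fixed complexDiracOp_zero n

theorem complexDiracOp_iterate_eq_zero_of_le {h : (Fin m → ℂ) → ComplexClifford m} {s n : ℕ}
    (hs : complexDiracOp^[s] h = 0) (hn : s ≤ n) : complexDiracOp^[n] h = 0 := by
  obtain ⟨k, rfl⟩ := Nat.exists_eq_add_of_le' hn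
  rw [Function.iterate_add_apply, hs, complexDiracOp_iterate_zero]

theorem complexDiracOp_iterate_sum_smul {ι : Type*} (S : Finset ι) (c : ι → ℝ)
    {p : ι → (Fin m → ℂ) → ComplexClifford m} (hp : ∀ i ∈ S, Differentiable ℂ (p i)) (n : ℕ) :
    complexDiracOp^[n] (fun z => ∑ i ∈ S, c i • p i z)
      = fun z => ∑ i ∈ S, c i • complexDiracOp^[n] (p i) z := by
  induction n generalizing p with
  | zero => rfl
  | succ n ih =>
    have h1 : complexDiracOp (fun z => ∑ i ∈ S, c i • p i z)
        = fun z => ∑ i ∈ S, c i • complexDiracOp (p i) z := by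
      funext z
      have h2 : HasFDerivAt (fun z => ∑ i ∈ S, c i • p i z) (∑ i ∈ S, c i • fderiv ℂ (p i) z) z :=
        HasFDerivAt.fun_sum fun i hi => ((hp i hi) z).hasFDerivAt.const_smul (c i)
      simp only [complexDiracOp, h2.fderiv, sum_apply, smul_apply, Finset.mul_sum, Finset.smul_sum,
        mul_smul_comm]
      rw [Finset.sum_comm]
    rw [Function.iterate_succ_apply, h1, ih fun i hi => differentiable_complexDiracOp (hp i hi)]
    rfl

theorem complexDiracOp_homComp {h : (Fin m → ℂ) → ComplexClifford m} (hh : Differentiable ℂ h)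
    (k : ℤ) : complexDiracOp (homComp h k) = homComp (complexDiracOp h) (k - 1) := by
  funext z
  have hc : ∀ j : Fin m, Continuous fun z => fderiv ℂ h z (Pi.single j 1) := fun j =>
    (differentiable_fderiv_apply hh _).continuous
  have h1 : complexDiracOp h
      = fun z => ∑ j, leftMul (cliffordGen j) (fderiv ℂ h z (Pi.single j 1)) := rfl
  rw [h1, homComp_sum (p := fun j z => leftMul (cliffordGen j) (fderiv ℂ h z (Pi.single j 1)))
    Finset.univ (fun j _ => (leftMul (cliffordGen j)).continuous.comp (hc j)), complexDiracOp]
  refine Finset.sum_congr rfl fun j _ => ?_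
  rw [fderiv_homComp hh, ← clm_homComp (leftMul (cliffordGen j)) (hc j)]
  simp

theorem complexDiracOp_iterate_homComp {h : (Fin m → ℂ) → ComplexClifford m}
    (hh : Differentiable ℂ h) (k : ℤ) (n : ℕ) :
    complexDiracOp^[n] (homComp h k) = homComp (complexDiracOp^[n] h) (k - n) := by
  induction n generalizing h k with
  | zero => simp
  | succ n ih =>
    rw [Function.iterate_succ_apply, complexDiracOp_homComp hh,
      ih (differentiable_complexDiracOp hh), Function.iterate_succ_apply]
    congr 1
    push_cast
    ring

theorem homComp_zero (k : ℤ) : homComp (0 : (Fin m → ℂ) → ComplexClifford m) k = 0 := by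
  funext z
  simp [homComp, circleCoeff]

/-- Termwise differentiation without uniform convergence: the n-fold derivative of the degree k
component is the degree k - n component of the derivative. The series is thus a shifted homogeneous
expansion, with n vanishing terms in front. -/
theorem hasSum_complexDiracOp_iterate_homComp {h : (Fin m → ℂ) → ComplexClifford m}
    (hh : Differentiable ℂ h) (n : ℕ) (z : Fin m → ℂ) :
    HasSum (fun k : ℕ => complexDiracOp^[n] (homComp h k) z) (complexDiracOp^[n] h z) := by
  have hd := differentiable_complexDiracOp_iterate hh n
  have h1 := hasSum_homComp hd z
  simp only [complexDiracOp_iterate_homComp hh]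
  have h2 := (hasSum_nat_add_iff (f := fun k : ℕ =>
    homComp (complexDiracOp^[n] h) ((k : ℤ) - n) z) n (g := complexDiracOp^[n] h z)).1 (by
      simpa using h1)
  rwa [Finset.sum_eq_zero fun k hk => homComp_of_neg hd
    (by have := Finset.mem_range.1 hk; omega) z, add_zero] at h2

theorem polyGrowth_homComp {h : (Fin m → ℂ) → ComplexClifford m} (hh : Differentiable ℂ h)
    (k : ℤ) : PolyGrowth fun x => homComp h k (ofRealPi m x) := by
  obtain ⟨C, hC, hb⟩ := exists_norm_homComp_le hh k
  refine ⟨C, k.toNat, hC, fun x => (hb _).trans ?_⟩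
  have : ‖ofRealPi m x‖ ≤ ‖x‖ :=
    (pi_norm_le_iff_of_nonneg (norm_nonneg x)).2 fun j => by simpa using norm_le_pi_norm x j
  gcongr

theorem memLp_of_polyGrowth {g : (Fin m → ℝ) → ComplexClifford m} (hg : PolyGrowth g)
    (hc : Continuous g) : MemLp (fun x => Real.exp (-(∑ j, x j ^ 2) / 4) • g x) 2 := by
  have hcf : Continuous fun x : Fin m → ℝ => Real.exp (-(∑ j, x j ^ 2) / 4) • g x := by fun_prop
  rw [memLp_two_iff_integrable_sq_norm hcf.aestronglyMeasurable]
  have h1 : PolyGrowth fun x => ‖g x‖ ^ 2 := by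
    obtain ⟨C, N, hC, h⟩ := hg
    refine ⟨C ^ 2, N * 2, by positivity, fun x => ?_⟩
    rw [pow_mul, ← mul_pow, Real.norm_eq_abs, abs_of_nonneg (by positivity)]
    exact pow_le_pow_left₀ (norm_nonneg _) (h x) 2
  refine (h1.integrable (by fun_prop)).congr (Filter.Eventually.of_forall fun x => ?_)
  simp only [smul_eq_mul, gaussWeight]
  rw [norm_smul, mul_pow, Real.norm_eq_abs, Real.abs_exp, ← Real.exp_nat_mul]
  congr 2
  push_cast
  ring

/-- The inverse heat operator on the kernel of a power of the Dirac operator. -/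
def inverseHeat (s : ℕ) (h : (Fin m → ℂ) → ComplexClifford m) (z : Fin m → ℂ) :
    ComplexClifford m :=
  ∑ k ∈ Finset.range s, heatCoeff k • complexDiracOp^[2 * k] h z

/-- The candidate preimage of `h` under the Segal-Bargmann transform. -/
def preimageFun (s : ℕ) (h : (Fin m → ℂ) → ComplexClifford m) (x : Fin m → ℝ) :
    ComplexClifford m :=
  Real.exp (-(∑ j, x j ^ 2) / 4) • inverseHeat s h (ofRealPi m x)

theorem differentiable_inverseHeat (s : ℕ) {h : (Fin m → ℂ) → ComplexClifford m}
    (hh : Differentiable ℂ h) : Differentiable ℂ (inverseHeat s h) :=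
  Differentiable.fun_sum fun k _ =>
    (differentiable_complexDiracOp_iterate hh (2 * k)).const_smul (heatCoeff k)

theorem inverseHeat_mem_realMonogenic {s : ℕ} {h : (Fin m → ℂ) → ComplexClifford m}
    (hh : h ∈ complexMonogenic m s) :
    (fun x => inverseHeat s h (ofRealPi m x)) ∈ realMonogenic m s := by
  have hd := differentiable_inverseHeat s hh.1
  refine ⟨contDiff_comp_ofRealPi hd, ?_⟩
  rw [diracOp_iterate_comp_ofRealPi hd]
  have h1 : complexDiracOp^[s] (inverseHeat s h) = fun z => ∑ k ∈ Finset.range s,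
      heatCoeff k • complexDiracOp^[s] (complexDiracOp^[2 * k] h) z :=
    complexDiracOp_iterate_sum_smul _ _
      (fun k _ => differentiable_complexDiracOp_iterate hh.1 (2 * k)) s
  funext x
  rw [h1]
  refine Finset.sum_eq_zero fun k _ => ?_
  rw [← Function.iterate_add_apply, complexDiracOp_iterate_eq_zero_of_le hh.2 (by omega)]
  simp

theorem continuous_preimageFun (s : ℕ) {h : (Fin m → ℂ) → ComplexClifford m}
    (hh : Differentiable ℂ h) : Continuous (preimageFun s h) := by
  have h1 := (contDiff_comp_ofRealPi (differentiable_inverseHeat s hh)).continuous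
  unfold preimageFun
  fun_prop

theorem homComp_mem_complexMonogenic {s : ℕ} {h : (Fin m → ℂ) → ComplexClifford m}
    (hh : h ∈ complexMonogenic m s) (k : ℤ) : homComp h k ∈ complexMonogenic m s :=
  ⟨differentiable_homComp hh.1 k, by
    rw [complexDiracOp_iterate_homComp hh.1, hh.2, homComp_zero]⟩

theorem memLp_preimageFun_homComp {s : ℕ} {h : (Fin m → ℂ) → ComplexClifford m}
    (hh : Differentiable ℂ h) (n : ℤ) : MemLp (preimageFun s (homComp h n)) 2 := by
  have h1 : preimageFun s (homComp h n) = fun x => ∑ k ∈ Finset.range s, heatCoeff k •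
      (Real.exp (-(∑ j, x j ^ 2) / 4) • complexDiracOp^[2 * k] (homComp h n) (ofRealPi m x)) := by
    funext x
    rw [preimageFun, inverseHeat, Finset.smul_sum]
    simp only [smul_comm (Real.exp _) (heatCoeff _)]
  rw [h1]
  refine memLp_finsetSum _ fun k _ => MemLp.const_smul ?_ (heatCoeff k)
  rw [complexDiracOp_iterate_homComp hh]
  have hd := differentiable_complexDiracOp_iterate hh (2 * k)
  exact memLp_of_polyGrowth (polyGrowth_homComp hd _)
    (contDiff_comp_ofRealPi (differentiable_homComp hd _)).continuous

/-- Polynomial growth of the component and its derivatives makes the flow argument applicable with u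
k = ∂^{2k} of the component. The total Gaussian mass (2π)^{m/2} cancels the prefactor, and equality
on ℝ^m extends to ℂ^m. -/
theorem segalBargmann_preimageFun_homComp {s : ℕ} {h : (Fin m → ℂ) → ComplexClifford m}
    (hh : h ∈ complexMonogenic m s) (n : ℤ) :
    segalBargmann (preimageFun s (homComp h n)) = homComp h n := by
  have hmem := memLp_preimageFun_homComp (s := s) hh.1 n
  have hdn := differentiable_homComp hh.1 n
  have hit := fun k => differentiable_complexDiracOp_iterate hdn k
  have hith := fun k => differentiable_complexDiracOp_iterate hh.1 k
  have hpart : ∀ (p : (Fin m → ℂ) → ComplexClifford m), Differentiable ℂ p → ∀ j,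
      partialD j (fun x => p (ofRealPi m x))
        = fun x => (fun z => fderiv ℂ p z (Pi.single j 1)) (ofRealPi m x) := fun p hp j => by
    funext x
    exact fderiv_comp_ofRealPi hp x j
  set u : ℕ → (Fin m → ℝ) → ComplexClifford m :=
    fun k x => complexDiracOp^[2 * k] (homComp h n) (ofRealPi m x) with hu
  have hsm : ∀ k, ContDiff ℝ (⊤ : ℕ∞) (u k) := fun k => contDiff_comp_ofRealPi (hit (2 * k))
  have hg0 : ∀ k, PolyGrowth (u k) := fun k => by
    simp only [hu, complexDiracOp_iterate_homComp hh.1]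
    exact polyGrowth_homComp (hith (2 * k)) _
  have hgrow : ∀ (p : (Fin m → ℂ) → ComplexClifford m), Differentiable ℂ p → ∀ (k : ℤ) (j : Fin m),
      (fun z => fderiv ℂ (homComp p k) z (Pi.single j 1))
        = homComp (fun z => fderiv ℂ p z (Pi.single j 1)) (k - 1) := fun p hp k j => by
    funext z
    exact fderiv_homComp hp k _ z
  have hg1 : ∀ k j, PolyGrowth (partialD j (u k)) := fun k j => by
    simp only [hu]
    rw [hpart _ (hit (2 * k)), complexDiracOp_iterate_homComp hh.1, hgrow _ (hith (2 * k))]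
    exact polyGrowth_homComp (differentiable_fderiv_apply (hith (2 * k)) _) _
  have hg2 : ∀ k j, PolyGrowth (partialD j (partialD j (u k))) := fun k j => by
    simp only [hu]
    rw [hpart _ (hit (2 * k)), hpart _ (differentiable_fderiv_apply (hit (2 * k)) _),
      complexDiracOp_iterate_homComp hh.1, hgrow _ (hith (2 * k)),
      hgrow _ (differentiable_fderiv_apply (hith (2 * k)) _)]
    exact polyGrowth_homComp (differentiable_fderiv_apply
      (differentiable_fderiv_apply (hith (2 * k)) _) _) _
  have hlap : ∀ k x, u (k + 1) x = -∑ j, partialD j (partialD j (u k)) x := fun k x => by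
    simp only [hu]
    rw [show 2 * (k + 1) = (2 * k + 1) + 1 by ring, Function.iterate_succ_apply',
      Function.iterate_succ_apply', complexDiracOp_complexDiracOp (hit (2 * k))]
    congr 1
    refine Finset.sum_congr rfl fun j _ => ?_
    rw [hpart _ (hit (2 * k)), hpart _ (differentiable_fderiv_apply (hit (2 * k)) _)]
  have hus : ∀ x, u s x = 0 := fun x => by
    simp only [hu]
    rw [complexDiracOp_iterate_eq_zero_of_le (homComp_mem_complexMonogenic hh n).2 (by omega)]
    rfl
  have hreal : ∀ x, segalBargmann (preimageFun s (homComp h n)) (ofRealPi m x)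
      = homComp h n (ofRealPi m x) := by
    intro x
    have key := sum_heatCoeff_smul_gaussAverage hsm hg0 hg1 hg2 hlap hus x
    rw [segalBargmann_eq]
    have h1 : kernelIntegral (preimageFun s (homComp h n)) (ofRealPi m x)
        = ∑ k ∈ Finset.range s, heatCoeff k • ∫ y, gaussWeight y • u k (x + y) := by
      have := kernelIntegral_ofReal (fun x => inverseHeat s (homComp h n) (ofRealPi m x)) x
      refine Eq.trans this ?_
      simp only [inverseHeat, Finset.smul_sum, smul_comm (Real.exp _) (heatCoeff _)]
      have hint : ∀ k, Integrable fun y => gaussWeight y • u k (x + y) := fun k => by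
        have := ((hg0 k).comp x 1).integrable
          ((hsm k).continuous.comp (by fun_prop : Continuous fun y : Fin m → ℝ => x + (1 : ℝ) • y))
        simpa using this
      refine (integral_finsetSum _ fun k _ => (hint k).smul (heatCoeff k)).trans ?_
      exact Finset.sum_congr rfl fun k _ =>
        integral_smul (heatCoeff k) fun y => gaussWeight y • u k (x + y)
    rw [h1, key, integral_gaussWeight, smul_smul, inv_mul_cancel₀ (by positivity), one_smul]
    rfl
  have hsub := eq_zero_of_real_eq_zero ((differentiable_segalBargmann hmem).sub hdn) fun x =>
    sub_eq_zero.2 (hreal x)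
  exact sub_eq_zero.1 hsub

end Inverse

/-! ### Surjectivity -/

section Surjectivity

variable {m : ℕ}

theorem lintegral_norm_sq_eq_segalBargmann {f : (Fin m → ℝ) → ComplexClifford m}
    (hf : MemLp f 2) :
    ∫⁻ x, ‖f x‖ₑ ^ 2 = ENNReal.ofReal ((2 * Real.pi) ^ ((m : ℝ) / 2) * (Real.pi ^ m)⁻¹) *
      ∫⁻ z : Fin m → ℂ, ENNReal.ofReal (Real.exp (-∑ j, ‖z j‖ ^ 2)) * ‖segalBargmann f z‖ₑ ^ 2 := by
  obtain ⟨h1, h2⟩ := integral_segalBargmann_sq hf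
  have h3 := (memLp_two_iff_integrable_sq_norm hf.aestronglyMeasurable).1 hf
  have e1 : ∫⁻ x, ‖f x‖ₑ ^ 2 = ENNReal.ofReal (∫ x, ‖f x‖ ^ 2) := by
    rw [ofReal_integral_eq_lintegral_ofReal h3 (Filter.Eventually.of_forall fun x => by positivity)]
    simp [ENNReal.ofReal_pow]
  have e2 : ∫⁻ z : Fin m → ℂ, ENNReal.ofReal (Real.exp (-∑ j, ‖z j‖ ^ 2)) *
      ‖segalBargmann f z‖ₑ ^ 2 = ENNReal.ofReal
        (∫ z : Fin m → ℂ, Real.exp (-∑ j, ‖z j‖ ^ 2) * ‖segalBargmann f z‖ ^ 2) := by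
    rw [ofReal_integral_eq_lintegral_ofReal h1 (Filter.Eventually.of_forall fun x => by positivity)]
    simp [ENNReal.ofReal_pow, ENNReal.ofReal_mul (Real.exp_pos _).le]
  rw [e1, e2, ← ENNReal.ofReal_mul (by positivity), mul_assoc, h2, ← mul_assoc,
    mul_inv_cancel₀ (by positivity), one_mul]

theorem segalBargmann_sum {ι : Type*} (S : Finset ι) {f : ι → (Fin m → ℝ) → ComplexClifford m}
    (hf : ∀ i ∈ S, MemLp (f i) 2) :
    segalBargmann (fun x => ∑ i ∈ S, f i x) = fun z => ∑ i ∈ S, segalBargmann (f i) z := by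
  funext z
  simp only [segalBargmann, Finset.smul_sum]
  rw [integral_finsetSum _ fun i hi => integrable_segalBargmannKernel_smul (hf i hi) z,
    Finset.smul_sum]

theorem segalBargmann_sub {f g : (Fin m → ℝ) → ComplexClifford m} (hf : MemLp f 2)
    (hg : MemLp g 2) (z : Fin m → ℂ) :
    segalBargmann (f - g) z = segalBargmann f z - segalBargmann g z := by
  simp only [segalBargmann, Pi.sub_apply, smul_sub]
  rw [integral_sub (integrable_segalBargmannKernel_smul hf z)
    (integrable_segalBargmannKernel_smul hg z), smul_sub]

/-- Pythagoras: the components of a finite sum of components are exactly the selected ones. -/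
theorem lintegral_weight_norm_sq_sum_homComp {h : (Fin m → ℂ) → ComplexClifford m}
    (hh : Differentiable ℂ h) (S : Finset ℕ) :
    ∫⁻ z : Fin m → ℂ, ENNReal.ofReal (Real.exp (-∑ j, ‖z j‖ ^ 2)) *
        ‖∑ n ∈ S, homComp h n z‖ₑ ^ 2
      = ∑ n ∈ S, ∫⁻ z : Fin m → ℂ, ENNReal.ofReal (Real.exp (-∑ j, ‖z j‖ ^ 2)) *
        ‖homComp h n z‖ₑ ^ 2 := by
  have hd : ∀ n : ℕ, Differentiable ℂ (homComp h n) := fun n => differentiable_homComp hh n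
  have h1 : ∀ (k : ℕ) z, homComp (fun z => ∑ n ∈ S, homComp h n z) k z
      = if k ∈ S then homComp h k z else 0 := fun k z => by
    rw [homComp_sum (p := fun (n : ℕ) z => homComp h n z) S fun n _ => (hd n).continuous]
    simp only [homComp_homComp hh, Nat.cast_inj, Finset.sum_ite_eq]
  rw [lintegral_weight_norm_sq (Differentiable.fun_sum fun n _ => hd n), tsum_eq_sum (s := S)]
  · exact Finset.sum_congr rfl fun n hn => by simp only [h1, hn, if_true]
  · intro n hn
    simp [h1, hn]

/-- Fatou's lemma in the form used for passing to limits of partial sums. -/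
theorem lintegral_le_of_tendsto {α : Type*} [MeasurableSpace α] {μ : Measure α}
    {φ : ℕ → α → ENNReal} {ψ : α → ENNReal} (hφ : ∀ n, Measurable (φ n))
    (hlim : ∀ x, Filter.Tendsto (fun n => φ n x) Filter.atTop (nhds (ψ x))) {C : ENNReal}
    (hC : ∀ᶠ n in Filter.atTop, ∫⁻ x, φ n x ∂μ ≤ C) : ∫⁻ x, ψ x ∂μ ≤ C := by
  have h1 : ψ = fun x => Filter.liminf (fun n => φ n x) Filter.atTop :=
    funext fun x => (hlim x).liminf_eq.symm
  rw [h1]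
  exact (lintegral_liminf_le hφ).trans
    (le_trans (Filter.liminf_le_limsup) (Filter.limsup_le_of_le (by isBoundedDefault) hC))

variable {s : ℕ} {h : (Fin m → ℂ) → ComplexClifford m}

theorem hasSum_preimageFun_homComp (hh : Differentiable ℂ h) (x : Fin m → ℝ) :
    HasSum (fun n : ℕ => preimageFun s (homComp h n) x) (preimageFun s h x) := by
  unfold preimageFun inverseHeat
  exact (hasSum_sum fun k _ => (hasSum_complexDiracOp_iterate_homComp hh (2 * k) _).const_smul
    (heatCoeff k)).const_smul _

/-- The tails of the homogeneous expansion of the preimage are controlled by the tails of the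
expansion in the Bargmann module. -/
theorem lintegral_preimageFun_sub_sum_le (hh : h ∈ complexMonogenic m s) (N : ℕ) :
    ∫⁻ x, ‖preimageFun s h x - ∑ n ∈ Finset.range N, preimageFun s (homComp h n) x‖ₑ ^ 2
      ≤ ENNReal.ofReal ((2 * Real.pi) ^ ((m : ℝ) / 2) * (Real.pi ^ m)⁻¹) *
        ∑' n : ℕ, ∫⁻ z : Fin m → ℂ, ENNReal.ofReal (Real.exp (-∑ j, ‖z j‖ ^ 2)) *
          ‖homComp h (n + N : ℕ) z‖ₑ ^ 2 := by
  have hc : ∀ n : ℕ, Continuous (preimageFun s (homComp h n)) := fun n =>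
    continuous_preimageFun s (differentiable_homComp hh.1 n)
  refine lintegral_le_of_tendsto
    (φ := fun M x => ‖∑ n ∈ Finset.range M, preimageFun s (homComp h n) x
      - ∑ n ∈ Finset.range N, preimageFun s (homComp h n) x‖ₑ ^ 2)
    (fun M => Continuous.measurable (by fun_prop)) (fun x => ?_) ?_
  · have h1 := (hasSum_preimageFun_homComp (s := s) hh.1 x).tendsto_sum_nat
    exact ((ENNReal.continuous_pow 2).tendsto _).comp
      ((continuous_enorm.tendsto _).comp (h1.sub_const _))
  -- For M ≥ N the difference is a finite block of preimages, known to lie in L² with known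
  -- transforms. The isometry and Pythagoras bound it by the tail from N on, uniformly in M.
  · filter_upwards [Filter.eventually_ge_atTop N] with M hM
    have h2 : ∀ x, ∑ n ∈ Finset.range M, preimageFun s (homComp h n) x
        - ∑ n ∈ Finset.range N, preimageFun s (homComp h n) x
        = ∑ n ∈ Finset.Ico N M, preimageFun s (homComp h n) x := fun x =>
      (Finset.sum_Ico_eq_sub _ hM).symm
    have hL : ∀ n ∈ Finset.Ico N M, MemLp (preimageFun s (homComp h (n : ℕ))) 2 := fun n _ =>
      memLp_preimageFun_homComp hh.1 n
    simp only [h2]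
    rw [lintegral_norm_sq_eq_segalBargmann (memLp_finsetSum _ hL), segalBargmann_sum _ hL]
    simp only [segalBargmann_preimageFun_homComp hh]
    rw [lintegral_weight_norm_sq_sum_homComp hh.1, Finset.sum_Ico_eq_sum_range]
    gcongr
    simp only [add_comm N]
    exact ENNReal.sum_le_tsum _

theorem tendsto_lintegral_preimageFun_sub_sum (hh : h ∈ monogenicBargmann m s) :
    Filter.Tendsto (fun N => ∫⁻ x,
      ‖preimageFun s h x - ∑ n ∈ Finset.range N, preimageFun s (homComp h n) x‖ₑ ^ 2)
      Filter.atTop (nhds 0) := by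
  have hfin : ∑' n : ℕ, ∫⁻ z : Fin m → ℂ, ENNReal.ofReal (Real.exp (-∑ j, ‖z j‖ ^ 2)) *
      ‖homComp h n z‖ₑ ^ 2 ≠ ⊤ := by
    rw [← lintegral_weight_norm_sq hh.1.1]
    have h1 := hh.2.2.lintegral_lt_top.ne
    simpa [ENNReal.ofReal_pow, ENNReal.ofReal_mul (Real.exp_pos _).le] using h1
  have h2 := ENNReal.Tendsto.const_mul (ENNReal.tendsto_sum_nat_add _ hfin)
    (Or.inr (ENNReal.ofReal_ne_top (r := (2 * Real.pi) ^ ((m : ℝ) / 2) * (Real.pi ^ m)⁻¹)))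
  rw [mul_zero] at h2
  exact tendsto_of_tendsto_of_tendsto_of_le_of_le tendsto_const_nhds h2 (fun _ => zero_le)
    (lintegral_preimageFun_sub_sum_le hh.1)

theorem memLp_two_of_lintegral {f : (Fin m → ℝ) → ComplexClifford m} (hc : Continuous f)
    (hf : ∫⁻ x, ‖f x‖ₑ ^ 2 ≠ ⊤) : MemLp f 2 := by
  rw [memLp_two_iff_integrable_sq_norm hc.aestronglyMeasurable]
  refine ⟨by fun_prop, ?_⟩
  rw [hasFiniteIntegral_iff_enorm]
  simpa [enorm_pow] using hf.lt_top

/-- The candidate is a finite partial sum plus a remainder of L² norm less than 1. -/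
theorem memLp_preimageFun (hh : h ∈ monogenicBargmann m s) : MemLp (preimageFun s h) 2 := by
  have hc := continuous_preimageFun s hh.1.1
  have hcn : ∀ n : ℕ, Continuous (preimageFun s (homComp h n)) := fun n =>
    continuous_preimageFun s (differentiable_homComp hh.1.1 n)
  obtain ⟨N, hN⟩ := ((tendsto_lintegral_preimageFun_sub_sum hh).eventually
    (gt_mem_nhds one_pos)).exists
  have h1 : MemLp (fun x => preimageFun s h x
      - ∑ n ∈ Finset.range N, preimageFun s (homComp h n) x) 2 :=
    memLp_two_of_lintegral (by fun_prop) (hN.trans ENNReal.one_lt_top).ne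
  have h2 : MemLp (fun x => ∑ n ∈ Finset.range N, preimageFun s (homComp h n) x) 2 :=
    memLp_finsetSum _ fun n _ => memLp_preimageFun_homComp hh.1.1 n
  exact (h1.add h2).congr_norm hc.aestronglyMeasurable (Filter.Eventually.of_forall fun x => by simp)

theorem measurable_weight_mul_enorm_sq {p : (Fin m → ℂ) → ComplexClifford m} (hp : Continuous p) :
    Measurable fun z : Fin m → ℂ => ENNReal.ofReal (Real.exp (-∑ j, ‖z j‖ ^ 2)) * ‖p z‖ₑ ^ 2 := by
  have h1 : Measurable fun z => ‖p z‖ₑ ^ 2 := Continuous.measurable (by fun_prop)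
  fun_prop

/-- By the isometry, the partial sums of the components of h tend to the transform in weighted L².
They also tend to h pointwise, so Fatou makes the weighted distance between the transform and h
zero, and continuity gives equality everywhere. -/
theorem segalBargmann_preimageFun (hh : h ∈ monogenicBargmann m s) :
    segalBargmann (preimageFun s h) = h := by
  have hF := memLp_preimageFun hh
  have hd := differentiable_segalBargmann hF
  have hFn : ∀ N, MemLp (fun x => ∑ n ∈ Finset.range N, preimageFun s (homComp h n) x) 2 :=
    fun N => memLp_finsetSum _ fun n _ => memLp_preimageFun_homComp hh.1.1 n
  have hcn : ∀ n : ℕ, Continuous (homComp h n) := fun n =>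
    (differentiable_homComp hh.1.1 n).continuous
  have hB : ∀ N z, segalBargmann (preimageFun s h
      - fun x => ∑ n ∈ Finset.range N, preimageFun s (homComp h n) x) z
      = segalBargmann (preimageFun s h) z - ∑ n ∈ Finset.range N, homComp h n z := fun N z => by
    rw [segalBargmann_sub hF (hFn N), segalBargmann_sum
      (f := fun n : ℕ => preimageFun s (homComp h n)) _ fun n _ =>
        memLp_preimageFun_homComp hh.1.1 n]
    simp only [segalBargmann_preimageFun_homComp hh.1]
  set K := ENNReal.ofReal ((2 * Real.pi) ^ ((m : ℝ) / 2) * (Real.pi ^ m)⁻¹) with hK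
  have hK0 : K ≠ 0 := (ENNReal.ofReal_pos.2 (by positivity)).ne'
  have hlim : Filter.Tendsto (fun N => ∫⁻ z : Fin m → ℂ,
      ENNReal.ofReal (Real.exp (-∑ j, ‖z j‖ ^ 2)) *
        ‖segalBargmann (preimageFun s h) z - ∑ n ∈ Finset.range N, homComp h n z‖ₑ ^ 2)
      Filter.atTop (nhds 0) := by
    have h1 := ENNReal.Tendsto.const_mul (tendsto_lintegral_preimageFun_sub_sum hh)
      (Or.inr (ENNReal.inv_ne_top.2 hK0))
    rw [mul_zero] at h1
    refine h1.congr fun N => ?_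
    have h2 := lintegral_norm_sq_eq_segalBargmann (hF.sub (hFn N))
    simp only [hB, Pi.sub_apply] at h2
    rw [h2, ← mul_assoc, ENNReal.inv_mul_cancel hK0 ENNReal.ofReal_ne_top, one_mul]
  have hzero : ∫⁻ z : Fin m → ℂ, ENNReal.ofReal (Real.exp (-∑ j, ‖z j‖ ^ 2)) *
      ‖segalBargmann (preimageFun s h) z - h z‖ₑ ^ 2 = 0 := by
    refine le_antisymm (le_of_forall_gt fun ε hε => ?_) zero_le
    obtain ⟨δ, hδ0, hδ⟩ := exists_between hε
    refine (lintegral_le_of_tendsto (φ := fun N z => ENNReal.ofReal (Real.exp (-∑ j, ‖z j‖ ^ 2)) *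
        ‖segalBargmann (preimageFun s h) z - ∑ n ∈ Finset.range N, homComp h n z‖ₑ ^ 2)
      (fun N => ?_) (fun z => ?_) ((hlim.eventually (gt_mem_nhds hδ0)).mono fun N hN => hN.le)
      ).trans_lt hδ
    · exact measurable_weight_mul_enorm_sq
        (hd.continuous.sub (continuous_finsetSum _ fun n _ => hcn n))
    · exact ENNReal.Tendsto.const_mul (((ENNReal.continuous_pow 2).tendsto _).comp
        ((continuous_enorm.tendsto _).comp ((hasSum_homComp hh.1.1 z).tendsto_sum_nat.const_sub _)))
        (Or.inr ENNReal.ofReal_ne_top)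
  have hcB := hd.continuous
  have hch := hh.1.1.continuous
  rw [lintegral_eq_zero_iff
    (measurable_weight_mul_enorm_sq (p := fun z => segalBargmann (preimageFun s h) z - h z)
      (hcB.sub hch))] at hzero
  refine hcB.ae_eq_iff_eq volume hch |>.1 ?_
  filter_upwards [hzero] with z hz
  simpa [(Real.exp_pos _).not_ge, sub_eq_zero] using hz

theorem preimageFun_mem_monogenicL2 (hh : h ∈ monogenicBargmann m s) :
    preimageFun s h ∈ monogenicL2 m s :=
  ⟨⟨_, inverseHeat_mem_realMonogenic hh.1, rfl⟩, memLp_preimageFun hh⟩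

end Surjectivity

/-! ### The module structure -/

section Module

variable {m s : ℕ} {f g : (Fin m → ℝ) → ComplexClifford m}

theorem continuous_of_mem_monogenicL2 (hf : f ∈ monogenicL2 m s) : Continuous f := by
  obtain ⟨⟨u, hu, rfl⟩, -⟩ := hf
  have := hu.1.continuous
  fun_prop

theorem mul_add_mul_mem_monogenicL2 (hf : f ∈ monogenicL2 m s) (hg : g ∈ monogenicL2 m s)
    (a b : ComplexClifford m) : (fun x => f x * a + g x * b) ∈ monogenicL2 m s := by
  refine ⟨?_, ((rightMul a).comp_memLp' hf.2).add ((rightMul b).comp_memLp' hg.2)⟩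
  obtain ⟨⟨u, hu, rfl⟩, -⟩ := hf
  obtain ⟨⟨v, hv, rfl⟩, -⟩ := hg
  refine ⟨fun x => u x * a + v x * b, ⟨?_, ?_⟩, ?_⟩
  · exact ((rightMul a).restrictScalars ℝ).contDiff.comp hu.1 |>.add
      (((rightMul b).restrictScalars ℝ).contDiff.comp hv.1)
  · rw [diracOp_mul_add_mul hu.1 hv.1, hu.2, hv.2]
    funext x
    simp
  · funext x
    simp [smul_add]

theorem segalBargmann_mul_add_mul (hf : MemLp f 2) (hg : MemLp g 2) (a b : ComplexClifford m) :
    segalBargmann (fun x => f x * a + g x * b)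
      = fun z => segalBargmann f z * a + segalBargmann g z * b := by
  funext z
  have hi := integrable_segalBargmannKernel_smul hf z
  have hj := integrable_segalBargmannKernel_smul hg z
  have h1 := (rightMul a).integral_comp_comm hi
  have h2 := (rightMul b).integral_comp_comm hj
  have h3 := integral_add ((rightMul a).integrable_comp hi) ((rightMul b).integrable_comp hj)
  rw [h1, h2] at h3
  simp only [rightMul_apply, smul_mul_assoc] at h3
  simp only [segalBargmann, smul_add, smul_mul_assoc]
  rw [h3, smul_add]

theorem segalBargmann_mem_monogenicBargmann (hf : f ∈ monogenicL2 m s) :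
    segalBargmann f ∈ monogenicBargmann m s := by
  have hd := differentiable_segalBargmann hf.2
  refine ⟨⟨hd, ?_⟩, hd, (integral_segalBargmann_sq hf.2).1⟩
  -- The scalar prefactor is treated as a one-term linear combination.
  have h1 := complexDiracOp_iterate_sum_smul {()}
    (fun _ => ((2 * Real.pi) ^ ((m : ℝ) / 2))⁻¹) (p := fun _ => kernelIntegral f)
    (fun _ _ => differentiable_kernelIntegral hf.2) s
  simp only [Finset.sum_singleton] at h1
  have h2 : complexDiracOp^[s] (kernelIntegral f) = 0 := by
    obtain ⟨⟨g, hg, rfl⟩, hL⟩ := hf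
    exact diracOp_iterate_kernelIntegral_eq_zero hg hL
  refine Eq.trans h1 ?_
  rw [h2]
  funext z
  simp

/-- The isometry gives equality almost everywhere. Elements of the domain are functions, not
classes, so their continuity is needed to conclude. -/
theorem segalBargmann_injOn : Set.InjOn segalBargmann (monogenicL2 m s) := by
  intro f hf g hg hfg
  have h1 := lintegral_norm_sq_eq_segalBargmann (hf.2.sub hg.2)
  have hcf := continuous_of_mem_monogenicL2 hf
  have hcg := continuous_of_mem_monogenicL2 hg
  simp only [segalBargmann_sub hf.2 hg.2, hfg, sub_self, enorm_zero, ne_eq, OfNat.ofNat_ne_zero,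
    not_false_eq_true, zero_pow, mul_zero, lintegral_zero, Pi.sub_apply] at h1
  rw [lintegral_eq_zero_iff (Continuous.measurable (by fun_prop))] at h1
  refine hcf.ae_eq_iff_eq volume hcg |>.1 ?_
  filter_upwards [h1] with x hx
  simpa [sub_eq_zero] using hx

end Module

end SegalBargmann

end

theorem proposition4p3 (m s : ℕ) :
    -- the integral defining the transform converges on the domain
    (∀ f ∈ monogenicL2 m s, ∀ z : Fin m → ℂ,
      Integrable (fun x => segalBargmannKernel z x • f x) volume) ∧
    -- the domain is a right module and the transform is right linear on it
    (∀ f ∈ monogenicL2 m s, ∀ g ∈ monogenicL2 m s, ∀ a b : ComplexClifford m,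
      (fun x => f x * a + g x * b) ∈ monogenicL2 m s ∧
      segalBargmann (fun x => f x * a + g x * b)
        = fun z => segalBargmann f z * a + segalBargmann g z * b) ∧
    -- it is a bijection of the domain onto the Bargmann module
    Set.BijOn segalBargmann (monogenicL2 m s) (monogenicBargmann m s) ∧
    -- it preserves the Clifford-valued inner products, whose integrals converge
    (∀ f ∈ monogenicL2 m s, ∀ g ∈ monogenicL2 m s,
      Integrable (fun x => cliffordDagger (f x) * g x) volume ∧
      Integrable (fun z : Fin m → ℂ => Real.exp (-∑ j, ‖z j‖ ^ 2) •
        (cliffordDagger (segalBargmann f z) * segalBargmann g z)) volume ∧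
      innerBargmann (segalBargmann f) (segalBargmann g) = innerL2 f g) ∧
    -- it preserves the norms
    (∀ f ∈ monogenicL2 m s,
      (Real.pi ^ m)⁻¹ * ∫ z : Fin m → ℂ,
          Real.exp (-∑ j, ‖z j‖ ^ 2) * ‖segalBargmann f z‖ ^ 2
        = ((2 * Real.pi) ^ ((m : ℝ) / 2))⁻¹ * ∫ x, ‖f x‖ ^ 2) := by
  open SegalBargmann in
  exact ⟨fun f hf z => integrable_segalBargmannKernel_smul hf.2 z,
    fun f hf g hg a b =>
      ⟨mul_add_mul_mem_monogenicL2 hf hg a b, segalBargmann_mul_add_mul hf.2 hg.2 a b⟩,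
    ⟨fun f hf => segalBargmann_mem_monogenicBargmann hf, segalBargmann_injOn,
      fun h hh => ⟨preimageFun s h, preimageFun_mem_monogenicL2 hh, segalBargmann_preimageFun hh⟩⟩,
    fun f hf g hg => integral_dagger_segalBargmann_mul hf.2 hg.2,
    fun f hf => (integral_segalBargmann_sq hf.2).2⟩
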